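/- Fix $\gamma\ge 1$, $0<v_+<1=v_-$, $\mu_0>0$, $\sigma>0$, $B_1^*\ge 0$ and normalize $\mu=1$. Let $a=v_+^{\gamma}\,\frac{1-v_+}{1-v_+^{\gamma}}$ and let $\bar v:\mathbb R\to(0,\infty)$ be a solution of $\bar v'=\bar v\,\big(\bar v-1+a(\bar v^{-\gamma}-1)\big)$ with $\bar v(-\infty)=1$ and $\bar v(+\infty)=v_+$. For $r=\mu/(2\mu+\eta)>0$ the gas-dynamical shock profile is $\hat v^r(x)=\bar v(rx)$. For $v>0$ and $\lambda\in\mathbb C$ put $$A(v,\lambda)=\begin{pmatrix}0&1&0&0\\ \lambda v& v&0&-\sigma B_1^* v\\ 0&0&0&\sigma\mu_0 v\\ 0&-B_1^*v&\lambda v&\sigma\mu_0v^2\end{pmatrix},\qquad A^r(x,\lambda)=A(\hat v^r(x),\lambda),\qquad A_\pm(\lambda)=A(v_\pm,\lambda),$$ so that $W'=A^r(x,\lambda)W$ is the first-order form, in $W=(w,w',\alpha,\alpha'/(\sigma\mu_0\hat v^r))$, of the reduced eigenvalue equations $$\lambda w+w'-\frac{B_1^*\alpha'}{\mu_0\hat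 v^r}=\frac{w''}{\hat v^r},\qquad \lambda\alpha+\alpha'-B_1^*w'=\frac{1}{\sigma\mu_0\hat v^r}\Big(\frac{\alpha'}{\hat v^r}\Big)'.$$ Let $\Lambda=\{\Re\lambda\ge0\}$ if $B_1^*\ne\sqrt{\mu_0v_+}$ and $B_1^*\neq\sqrt{\mu_0v_-}=\sqrt{\mu_0}$, and $\Lambda=\{\Re\lambda\ge0\}\setminus\{0\}$ otherwise. Let $\Pi_+(\lambda)$ be the eigenprojection of $A_+(\lambda)$ onto its stable subspace (along the unstable one) and $\Pi_-(\lambda)$ that of $A_-(\lambda)$ onto its unstable subspace (along the stable one). Let $R^\pm=(R_1^\pm,R_2^\pm)$ be $4\times2$ matrix functions on $\Lambda$, independent of $r$, that are continuous on $\Lambda$, solve Kato's ODE $\frac{dR^\pm}{d\lambda}=\frac{d\Pi_\pm}{d\lambda}R^\pm$ on $\{\Re\lambda>0\}$, and whose columns are at some point $\lambda_0^\pm$ with $\Re\lambda_0^\pm>0$ a basis of the range of $\Pi_\pm(\lambda_0^\pm)$. The reduced Evans function is $D^r(\lambda)=\det\big(P^+R_1^+,P^+R_2^+,P^-R_1^-,P^-R_2^-\big)\big|_{x=0}$,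 where $P^\pm=P^{\pm}_r(x,\lambda)$, for $x\gtrless0$, are conjugators: invertible $4\times 4$ matrices with $\partial_xP^\pm=A^rP^\pm-P^\pm A_\pm$ and $|P^\pm-I|\le Ce^{-\theta|x|}$ for some $C$ and some $\theta>0$. Then: 1. for every $\lambda\in\Lambda\setminus\{0\}$ the columns of $R^+(\lambda)$ are a basis of the stable subspace of $A_+(\lambda)$ and those of $R^-(\lambda)$ a basis of the unstable subspace of $A_-(\lambda)$; 2. for every compact $K\subset\Lambda$ there is $r_0>0$ such that for all $r\ge r_0$ and all $\lambda\in K$ the value $D^r(\lambda)$ is well defined (conjugators exist, and the determinant does not depend on their choice), and, as $r\to\infty$, $D^r$ converges uniformly on $K$ to $D^0(\lambda)=\det\big(R^+(\lambda),R^-(\lambda)\big)$. -/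

import Mathlib

open Filter Topology Set

noncomputable section

/-! ## The gas-dynamical shock profile -/

/-- The coefficient `a = v₊^γ (1 - v₊) / (1 - v₊^γ)` given by the Rankine--Hugoniot condition for
the endstates `v₋ = 1`, `v₊`. -/
def rankineHugoniot (γ vp : ℝ) : ℝ := vp ^ γ * (1 - vp) / (1 - vp ^ γ)

/-- `v` is a shock profile with endstates `v₋ = 1` and `v₊ = vp` for the viscosity coefficient
`κ = 2 μ + η`: a positive solution of `κ v' = v (v - 1 + a (v^(-γ) - 1))` that tends to `1` at
`-∞` and to `vp` at `+∞`. -/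
structure IsShockProfile (γ vp κ : ℝ) (v : ℝ → ℝ) : Prop where
  pos : ∀ x, 0 < v x
  ode : ∀ x, ∃ v' : ℝ, HasDerivAt v v' x ∧
    κ * v' = v x * (v x - 1 + rankineHugoniot γ vp * ((v x) ^ (-γ) - 1))
  tendsto_atBot : Tendsto v atBot (𝓝 1)
  tendsto_atTop : Tendsto v atTop (𝓝 vp)

/-- With `μ = 1` and `r = μ / (2 μ + η)`, the profile for `r` is the rescaling `x ↦ vbar (r x)` of
the profile for `2 μ + η = 1`. -/
theorem IsShockProfile.rescale {γ vp : ℝ} {vbar : ℝ → ℝ} (h : IsShockProfile γ vp 1 vbar)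
    {r : ℝ} (hr : 0 < r) : IsShockProfile γ vp (1 / r) (fun x => vbar (r * x)) where
  pos x := h.pos _
  ode x := by
    obtain ⟨v', h1, h2⟩ := h.ode (r * x)
    refine ⟨v' * r, h1.comp x (by simpa using (hasDerivAt_id x).const_mul r), ?_⟩
    rw [← h2]
    field_simp
  tendsto_atBot := h.tendsto_atBot.comp (tendsto_id.const_mul_atBot hr)
  tendsto_atTop := h.tendsto_atTop.comp (tendsto_id.const_mul_atTop hr)

/-! ## The first-order system -/

/-- The coefficient matrix (with `μ = 1`) of the reduced eigenvalue equations
`z w + w' - B α' / (μ₀ v) = w'' / v`, `z α + α' - B w' = (α' / v)' / (σ μ₀ v)`, written as a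
first-order system in the unknown `(w, w', α, α' / (σ μ₀ v))`, at density value `v` and
frequency `z`. -/
def coeffMatrix (μ₀ σ B v : ℝ) (z : ℂ) : Matrix (Fin 4) (Fin 4) ℂ :=
  !![0, 1, 0, 0;
     z * v, v, 0, -(σ * B * v);
     0, 0, 0, σ * μ₀ * v;
     0, -(B * v), z * v, σ * μ₀ * v ^ 2]

/-! ## Stable and unstable subspaces, and Kato's ODE -/

/-- The stable subspace: the sum of the generalized eigenspaces for the eigenvalues of negative
real part. -/
def stableSubspace {n : ℕ} (M : Matrix (Fin n) (Fin n) ℂ) : Submodule ℂ (Fin n → ℂ) :=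
  ⨆ κ : ℂ, ⨆ _ : κ.re < 0, Module.End.maxGenEigenspace (Matrix.toLin' M) κ

/-- The unstable subspace: the sum of the generalized eigenspaces for the eigenvalues of positive
real part. -/
def unstableSubspace {n : ℕ} (M : Matrix (Fin n) (Fin n) ℂ) : Submodule ℂ (Fin n → ℂ) :=
  ⨆ κ : ℂ, ⨆ _ : 0 < κ.re, Module.End.maxGenEigenspace (Matrix.toLin' M) κ

open Classical in
/-- The matrix of the projection onto `S` along `T` (zero if `S` and `T` are not complementary). -/
def projMatrix {n : ℕ} (S T : Submodule ℂ (Fin n → ℂ)) : Matrix (Fin n) (Fin n) ℂ :=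
  if h : IsCompl S T then LinearMap.toMatrix' (S.projection T h) else 0

/-- The eigenprojection onto the stable subspace (along the unstable subspace). -/
def stableProj {n : ℕ} (M : Matrix (Fin n) (Fin n) ℂ) : Matrix (Fin n) (Fin n) ℂ :=
  projMatrix (stableSubspace M) (unstableSubspace M)

/-- The eigenprojection onto the unstable subspace (along the stable subspace). -/
def unstableProj {n : ℕ} (M : Matrix (Fin n) (Fin n) ℂ) : Matrix (Fin n) (Fin n) ℂ :=
  projMatrix (unstableSubspace M) (stableSubspace M)

/-- `R` is a Kato basis on `Λ`, for the projections `Pr z`: it solves Kato's ODE `R' = Pr' R` on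
the open right half-plane, its columns are at some point `z₀` of the open right half-plane a basis
of the range of `Pr z₀`, and it is continuous on `Λ`, which determines its values at the points
of `Λ` on the imaginary axis. -/
structure IsKatoBasis (Pr : ℂ → Matrix (Fin 4) (Fin 4) ℂ) (Λ : Set ℂ)
    (R : ℂ → Matrix (Fin 4) (Fin 2) ℂ) : Prop where
  ode : ∀ z : ℂ, 0 < z.re → HasDerivAt R (deriv Pr z * R z) z
  init : ∃ z₀ : ℂ, 0 < z₀.re ∧ LinearIndependent ℂ (R z₀).col ∧
    Submodule.span ℂ (range (R z₀).col) = LinearMap.range (Matrix.toLin' (Pr z₀))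
  continuousOn : ContinuousOn R Λ

/-- The set of frequencies on which the Kato bases, hence the reduced Evans function, are defined:
the closed right half-plane, without the point `0` in the characteristic cases `B = √(μ₀ v₊)` and
`B = √(μ₀ v₋)`, `v₋ = 1`, in which they are singular there. -/
def evansDomain (μ₀ B vp : ℝ) : Set ℂ :=
  {z | 0 ≤ z.re ∧ (z = 0 → B ≠ √(μ₀ * vp) ∧ B ≠ √μ₀)}

/-! ## Conjugators and the reduced Evans function -/

/-- `P` is a conjugator on the half-line `I`: the change of coordinates `W = P Z` is invertible,
it takes `Z' = Ainf Z` to `W' = A(x) W` on `I`, and `P` tends to the identity at exponential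
rate. -/
structure IsConjugator (A : ℝ → Matrix (Fin 4) (Fin 4) ℂ) (Ainf : Matrix (Fin 4) (Fin 4) ℂ)
    (I : Set ℝ) (P : ℝ → Matrix (Fin 4) (Fin 4) ℂ) : Prop where
  ode : ∀ x ∈ I, HasDerivWithinAt P (A x * P x - P x * Ainf) I x
  isUnit : ∀ x ∈ I, IsUnit (P x)
  decay : ∃ C θ : ℝ, 0 < θ ∧ ∀ x ∈ I, ∀ i j,
    ‖P x i j - (1 : Matrix (Fin 4) (Fin 4) ℂ) i j‖ ≤ C * Real.exp (-θ * |x|)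

/-- The determinant of the `4 × 4` matrix `(X₁, X₂, Y₁, Y₂)` formed by the columns of `X`, `Y`. -/
def detCols (X Y : Matrix (Fin 4) (Fin 2) ℂ) : ℂ :=
  (Matrix.of fun i => ![X i 0, X i 1, Y i 0, Y i 1]).det

/-- `d = det (P⁺ R₁⁺, P⁺ R₂⁺, P⁻ R₁⁻, P⁻ R₂⁻)` at `x = 0` for some conjugators `P⁺` on `[0, ∞)`
and `P⁻` on `(-∞, 0]` of the system with density profile `v`, at the frequency `z`. -/
def IsEvansValue (μ₀ σ B vp : ℝ) (Rp Rm : ℂ → Matrix (Fin 4) (Fin 2) ℂ) (v : ℝ → ℝ) (z d : ℂ) :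
    Prop :=
  ∃ Pp Pm : ℝ → Matrix (Fin 4) (Fin 4) ℂ,
    IsConjugator (fun x => coeffMatrix μ₀ σ B (v x) z) (coeffMatrix μ₀ σ B vp z) (Ici 0) Pp ∧
    IsConjugator (fun x => coeffMatrix μ₀ σ B (v x) z) (coeffMatrix μ₀ σ B 1 z) (Iic 0) Pm ∧
    d = detCols (Pp 0 * Rp z) (Pm 0 * Rm z)

/-- The reduced Evans function for the density profile `v`: the common value of the determinants
`det (P⁺ R₁⁺, P⁺ R₂⁺, P⁻ R₁⁻, P⁻ R₂⁻)` at `x = 0`, which do not depend on the conjugators. -/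
def reducedEvans (μ₀ σ B vp : ℝ) (Rp Rm : ℂ → Matrix (Fin 4) (Fin 2) ℂ) (v : ℝ → ℝ) (z : ℂ) : ℂ :=
  Classical.epsilon (IsEvansValue μ₀ σ B vp Rp Rm v z)

end

/-!
For large `r` the profile `vbar (r x)` relaxes to its endstates at a rate `θ r`, so the coefficient
matrix `A(x)` differs from its limit `A∞` by `O (e^{-θ r |x|})` on each half-line. In the unknown
`Z = e^{-x A∞} P e^{x A∞}` the equation for a conjugator `P` is `Z' = N Z` with a coefficient `N`
that is exponentially small as soon as `θ r` is large compared with the norm of `A∞`, without any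
spectral information, and `Z = 1 - ∫_x^∞ N Z` is solved by contraction; the deviation of `P` from
the identity is `O (1 / r)` (`exists_conjugator`). Hence conjugators exist uniformly for `z` in a
compact set and their values at `x = 0` tend to the identity (`eventually_exists_isConjugator`),
which gives the uniform convergence of the determinants.

That the determinant does not depend on the conjugators holds because it depends on the columns
`R₁, R₂` only through the bivector `R₁ ∧ R₂` (`detCols_congr`), here encoded as an antisymmetric
matrix on which a matrix `A` acts by `X ↦ A X + X Aᵀ`. For a basis of the stable subspace this
bivector is an eigenvector for the eigenvalue of least real part (`isLeastBivector_of_basis`). Two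
conjugators differ by a matrix `S` for which `e^{x A} S e^{-x A} - 1` decays exponentially; the
change `S η Sᵀ - η` of such an eigenvector `η` decays under the flow of `A` on bivectors at a rate
faster than that of every eigenvector, so it vanishes (`IsConjugator.bivector_unique`). Being a
least eigenvector is a closed condition (`IsLeastBivector.of_tendsto`); this covers `z = 0`, where
the splitting into stable and unstable subspaces is lost.

That the columns of the Kato bases remain bases of the stable subspaces rests on three facts. By an
energy estimate the coefficient matrix has no imaginary eigenvalue for `0 ≤ Re z`, `z ≠ 0`
(`re_ne_zero_of_mem_spectrum_coeffMatrix`). The stable projection is then locally a Riesz integral,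
hence holomorphic up to the imaginary axis away from `0`. Finally, a solution of Kato's equation
that lies in the range of the projection at one point does so everywhere, and its columns stay
independent, by uniqueness for linear differential equations along paths
(`IsKatoBasis.basis_stableSubspace`). The unstable subspace at `-∞` is treated as the stable
subspace of the negated matrix, under the reflection `x ↦ -x`.
-/

/-! ### Decay of the profile to its endstates -/

/-- Exponential convergence to an equilibrium `c` of a scalar equation `v' = h v` whose
linearization at `c` is stable. -/
theorem exists_exp_decay_of_hasDerivAt_neg {h v : ℝ → ℝ} {c h' : ℝ} (hc : h c = 0)
    (hh : HasDerivAt h h' c) (hh' : h' < 0) (hv : ∀ x, HasDerivAt v (h (v x)) x)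
    (hlim : Tendsto v atTop (𝓝 c)) :
    ∃ C θ : ℝ, 0 < C ∧ 0 < θ ∧ ∀ x, 0 ≤ x → |v x - c| ≤ C * Real.exp (-θ * x) := by
  have hlin : ∀ᶠ y in 𝓝 c, (y - c) * h y ≤ h' / 2 * (y - c) ^ 2 := by
    have h1 := (hasDerivAt_iff_isLittleO.1 hh).def (show (0 : ℝ) < -h' / 2 by linarith)
    filter_upwards [h1] with y hy
    rw [hc, sub_zero, smul_eq_mul, Real.norm_eq_abs, Real.norm_eq_abs] at hy
    have h2 : (y - c) * (h y - (y - c) * h') ≤ -h' / 2 * (y - c) ^ 2 := by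
      calc (y - c) * (h y - (y - c) * h') ≤ |(y - c) * (h y - (y - c) * h')| := le_abs_self _
        _ = |y - c| * |h y - (y - c) * h'| := abs_mul _ _
        _ ≤ |y - c| * (-h' / 2 * |y - c|) := by gcongr
        _ = -h' / 2 * (|y - c| ^ 2) := by ring
        _ = _ := by rw [sq_abs]
    nlinarith
  obtain ⟨X, hX⟩ := eventually_atTop.1 (hlim.eventually hlin)
  set X' := max X 0
  have hcont : Continuous v := continuous_iff_continuousAt.2 fun x => (hv x).continuousAt
  -- Once `v` is near `c`, half of the linear rate is available, so `(v - c)² e^{-h' x}` decreases.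
  set E : ℝ → ℝ := fun x => (v x - c) ^ 2 * Real.exp (-h' * x)
  have hE : ∀ x, HasDerivAt E ((2 * ((v x - c) * h (v x)) - h' * (v x - c) ^ 2)
      * Real.exp (-h' * x)) x := by
    intro x
    have h1 : HasDerivAt (fun x => (v x - c) ^ 2) (2 * ((v x - c) * h (v x))) x := by
      refine (((hv x).sub_const c).fun_pow 2).congr_deriv ?_
      simp
      ring
    have h2 : HasDerivAt (fun x => Real.exp (-h' * x)) (Real.exp (-h' * x) * -h') x := by
      simpa using ((hasDerivAt_id x).const_mul (-h')).exp
    exact (h1.fun_mul h2).congr_deriv (by ring)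
  have hanti : AntitoneOn E (Ici X') := by
    refine antitoneOn_of_deriv_nonpos (convex_Ici _)
      (fun x _ => (hE x).continuousAt.continuousWithinAt)
      (fun x _ => (hE x).differentiableAt.differentiableWithinAt) fun x hx => ?_
    rw [interior_Ici, mem_Ioi] at hx
    rw [(hE x).deriv]
    have := hX x ((le_max_left _ _).trans hx.le)
    exact mul_nonpos_of_nonpos_of_nonneg (by linarith) (Real.exp_pos _).le
  have hEcont : Continuous E := continuous_iff_continuousAt.2 fun x => (hE x).continuousAt
  obtain ⟨D, hD⟩ := (isCompact_Icc (a := (0 : ℝ)) (b := X')).bddAbove_image hEcont.continuousOn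
  have hbound : ∀ x, 0 ≤ x → E x ≤ D := by
    intro x hx
    rcases le_total x X' with h1 | h1
    · exact hD ⟨x, ⟨hx, h1⟩, rfl⟩
    · exact (hanti self_mem_Ici h1 h1).trans (hD ⟨X', ⟨le_max_right _ _, le_rfl⟩, rfl⟩)
  have hD0 : 0 ≤ D := le_trans (by positivity) (hbound 0 le_rfl)
  refine ⟨√D + 1, -h' / 2, by positivity, by linarith, fun x hx => ?_⟩
  have h1 := hbound x hx
  have h2 : (v x - c) ^ 2 ≤ (√D * Real.exp (- (-h' / 2) * x)) ^ 2 := by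
    rw [mul_pow, Real.sq_sqrt hD0, ← Real.exp_nat_mul]
    have h3 : (v x - c) ^ 2 = E x * Real.exp (h' * x) := by
      simp only [E]
      rw [mul_assoc, ← Real.exp_add]; simp
    rw [h3]
    have : ((2 : ℕ) : ℝ) * (-(-h' / 2) * x) = h' * x := by push_cast; ring
    rw [this]
    gcongr
  refine (abs_le_of_sq_le_sq h2 (by positivity)).trans ?_
  gcongr
  linarith

/-- The vector field `h` of the profile equation `v' = h v`. -/
noncomputable def profileField (γ vp v : ℝ) : ℝ :=
  v * (v - 1 + rankineHugoniot γ vp * (v ^ (-γ) - 1))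

theorem hasDerivAt_profileField (γ vp : ℝ) {v : ℝ} (hv : 0 < v) :
    HasDerivAt (profileField γ vp) ((v - 1 + rankineHugoniot γ vp * (v ^ (-γ) - 1)) +
      v * (1 + rankineHugoniot γ vp * (-γ * v ^ (-γ - 1)))) v := by
  have h1 : HasDerivAt (fun v : ℝ => v ^ (-γ)) (-γ * v ^ (-γ - 1)) v :=
    Real.hasDerivAt_rpow_const (Or.inl hv.ne')
  have h2 := ((hasDerivAt_id v).sub_const 1).add
    ((h1.sub_const 1).const_mul (rankineHugoniot γ vp))
  exact ((hasDerivAt_id v).mul h2).congr_deriv (by simp)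

/-- Both end states of the profile are hyperbolic rest points: `v = 1` is unstable and `v = v₊`
is stable. Both signs come from Bernoulli's inequality. -/
theorem exists_hasDerivAt_profileField {γ vp : ℝ} (hγ : 1 ≤ γ) (hvp : 0 < vp) (hvp1 : vp < 1) :
    (profileField γ vp 1 = 0 ∧ ∃ d, 0 < d ∧ HasDerivAt (profileField γ vp) d 1) ∧
    (profileField γ vp vp = 0 ∧ ∃ d, d < 0 ∧ HasDerivAt (profileField γ vp) d vp) := by
  have hp : 0 < vp ^ γ := Real.rpow_pos_of_pos hvp γ
  have hp1 : vp ^ γ < 1 := Real.rpow_lt_one hvp.le hvp1 (by linarith)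
  have hneg : vp ^ (-γ) = (vp ^ γ)⁻¹ := Real.rpow_neg hvp.le γ
  have hz : vp - 1 + rankineHugoniot γ vp * (vp ^ (-γ) - 1) = 0 := by
    rw [hneg, rankineHugoniot]
    have : (1 - vp ^ γ) ≠ 0 := by linarith
    field_simp
    ring
  have ha : rankineHugoniot γ vp * (1 - vp ^ γ) = vp ^ γ * (1 - vp) := by
    rw [rankineHugoniot]
    have : (1 - vp ^ γ) ≠ 0 := by linarith
    field_simp
  set a := rankineHugoniot γ vp
  refine ⟨⟨by simp [profileField], _, ?_, hasDerivAt_profileField γ vp one_pos⟩,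
    ⟨by rw [profileField, hz, mul_zero], _, ?_, hasDerivAt_profileField γ vp hvp⟩⟩
  · have hb : 1 + γ * (1 / vp - 1) ≤ (1 / vp) ^ γ := by
      have := one_add_mul_self_le_rpow_one_add
        (s := 1 / vp - 1) (by have : 0 < 1 / vp := by positivity
                              linarith) hγ
      simpa using this
    rw [Real.div_rpow one_pos.le hvp.le, Real.one_rpow] at hb
    have h1 : γ * vp ^ γ * (1 - vp) ≤ (1 - vp ^ γ) * vp := by
      have : (1 + γ * (1 / vp - 1)) * (vp ^ γ * vp) ≤ 1 / vp ^ γ * (vp ^ γ * vp) := by gcongr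
      field_simp at this
      nlinarith
    have h2 : a * γ < 1 := by
      have h3 : a * γ * (1 - vp ^ γ) ≤ (1 - vp ^ γ) * vp := by nlinarith
      have : a * γ ≤ vp := by
        have := (mul_le_mul_iff_left₀ (show 0 < 1 - vp ^ γ by linarith)).1
          (h3.trans_eq (mul_comm _ _))
        exact this
      linarith
    show 0 < (1 - 1 + a * ((1 : ℝ) ^ (-γ) - 1)) + 1 * (1 + a * (-γ * (1 : ℝ) ^ (-γ - 1)))
    simp only [Real.one_rpow]
    linarith
  · rw [hz, zero_add]
    have hb : 1 + γ * (vp - 1) ≤ vp ^ γ := by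
      simpa using one_add_mul_self_le_rpow_one_add (s := vp - 1) (by linarith) hγ
    have h1 : vp ^ (-γ - 1) = (vp ^ γ)⁻¹ / vp := by
      rw [Real.rpow_sub_one hvp.ne', hneg]
    rw [h1]
    have h2 : vp * (1 + a * (-γ * ((vp ^ γ)⁻¹ / vp))) = vp - a * γ / vp ^ γ := by
      field_simp
      ring
    rw [h2, sub_neg, lt_div_iff₀ hp]
    have h3 : vp * vp ^ γ * (1 - vp ^ γ) < a * γ * (1 - vp ^ γ) := by
      have : vp * (1 - vp ^ γ) < γ * (1 - vp) := by nlinarith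
      calc _ = vp ^ γ * (vp * (1 - vp ^ γ)) := by ring
        _ < vp ^ γ * (γ * (1 - vp)) := by gcongr
        _ = _ := by linear_combination (-γ) * ha
    exact lt_of_mul_lt_mul_right h3 (by linarith)

theorem IsShockProfile.hasDerivAt {γ vp : ℝ} {v : ℝ → ℝ} (h : IsShockProfile γ vp 1 v) (x : ℝ) :
    HasDerivAt v (profileField γ vp (v x)) x := by
  obtain ⟨v', h1, h2⟩ := h.ode x
  rwa [profileField, ← h2, one_mul]

theorem IsShockProfile.continuous {γ vp : ℝ} {v : ℝ → ℝ} (h : IsShockProfile γ vp 1 v) :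
    Continuous v :=
  continuous_iff_continuousAt.2 fun x => (h.hasDerivAt x).continuousAt

theorem IsShockProfile.exists_decay_atTop {γ vp : ℝ} (hγ : 1 ≤ γ) (hvp : 0 < vp) (hvp1 : vp < 1)
    {v : ℝ → ℝ} (h : IsShockProfile γ vp 1 v) :
    ∃ C θ : ℝ, 0 < C ∧ 0 < θ ∧ ∀ x, 0 ≤ x → |v x - vp| ≤ C * Real.exp (-θ * x) := by
  obtain ⟨-, h0, d, hd, hd'⟩ := exists_hasDerivAt_profileField hγ hvp hvp1
  exact exists_exp_decay_of_hasDerivAt_neg h0 hd' hd h.hasDerivAt h.tendsto_atTop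

theorem IsShockProfile.exists_decay_atBot {γ vp : ℝ} (hγ : 1 ≤ γ) (hvp : 0 < vp) (hvp1 : vp < 1)
    {v : ℝ → ℝ} (h : IsShockProfile γ vp 1 v) :
    ∃ C θ : ℝ, 0 < C ∧ 0 < θ ∧ ∀ x, 0 ≤ x → |v (-x) - 1| ≤ C * Real.exp (-θ * x) := by
  obtain ⟨⟨h0, d, hd, hd'⟩, -⟩ := exists_hasDerivAt_profileField hγ hvp hvp1
  refine exists_exp_decay_of_hasDerivAt_neg (h := fun y => -profileField γ vp y)
    (v := fun x => v (-x)) (by simp [h0]) hd'.neg (by linarith) (fun x => ?_)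
    (h.tendsto_atBot.comp tendsto_neg_atTop_atBot)
  exact ((h.hasDerivAt (-x)).comp x (hasDerivAt_neg x)).congr_deriv (by simp)

/-! ### Existence of conjugators -/

theorem norm_exp_smul_le {𝔸 : Type*} [NormedRing 𝔸] [NormedAlgebra ℝ 𝔸] [NormOneClass 𝔸]
    (X : 𝔸) (x : ℝ) :
    ‖NormedSpace.exp (x • X)‖ ≤ Real.exp (|x| * ‖X‖) := by
  have h := NormedSpace.expSeries_div_hasSum_exp (𝔸 := ℝ) (|x| * ‖X‖)
  rw [← Real.exp_eq_exp_ℝ] at h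
  rw [NormedSpace.exp_eq_tsum ℝ]
  refine tsum_of_norm_bounded h fun n => ?_
  rw [norm_smul, norm_inv, div_eq_inv_mul]
  have : ‖(n.factorial : ℝ)‖ = n.factorial := by simp
  rw [this]
  gcongr
  refine (norm_pow_le _ _).trans ?_
  rw [norm_smul, Real.norm_eq_abs]

theorem exp_smul_mul_exp_neg_smul {𝔸 : Type*} [NormedRing 𝔸] [NormedAlgebra ℝ 𝔸]
    [CompleteSpace 𝔸] (X : 𝔸) (x : ℝ) :
    NormedSpace.exp (x • X) * NormedSpace.exp ((-x) • X) = 1 := by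
  let := NormedAlgebra.restrictScalars ℚ ℝ 𝔸
  rw [← NormedSpace.exp_add_of_commute (((Commute.refl X).smul_left _).smul_right _), ← add_smul]
  simp

theorem exp_neg_smul_mul_exp_smul {𝔸 : Type*} [NormedRing 𝔸] [NormedAlgebra ℝ 𝔸]
    [CompleteSpace 𝔸] (X : 𝔸) (x : ℝ) :
    NormedSpace.exp ((-x) • X) * NormedSpace.exp (x • X) = 1 := by
  simpa using exp_smul_mul_exp_neg_smul X (-x)

theorem hasDerivAt_exp_neg_smul {𝔸 : Type*} [NormedRing 𝔸] [NormedAlgebra ℝ 𝔸] [CompleteSpace 𝔸]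
    (X : 𝔸) (x : ℝ) :
    HasDerivAt (fun x : ℝ => NormedSpace.exp ((-x) • X)) (-(NormedSpace.exp ((-x) • X) * X)) x := by
  have := (hasDerivAt_exp_smul_const X (-x)).scomp x (hasDerivAt_neg x)
  simpa [Function.comp_def] using this

theorem norm_integral_Ioi_le_exp {𝔸 : Type*} [NormedRing 𝔸] [NormedAlgebra ℝ 𝔸]
    {f : ℝ → 𝔸} {b k x : ℝ} (hk : 0 < k)
    (hf : ∀ y, x ≤ y → ‖f y‖ ≤ b * Real.exp (-k * y)) :
    ‖∫ y in Ioi x, f y‖ ≤ b / k * Real.exp (-k * x) := by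
  have h := MeasureTheory.norm_integral_le_of_norm_le (f := f)
    ((integrableOn_exp_mul_Ioi (neg_neg_of_pos hk) x).const_mul b)
    (by filter_upwards [MeasureTheory.ae_restrict_mem measurableSet_Ioi] with y hy
        exact hf y (le_of_lt hy))
  refine h.trans_eq ?_
  rw [MeasureTheory.integral_const_mul, integral_exp_mul_Ioi (neg_neg_of_pos hk)]
  field_simp

theorem integrableOn_Ioi_of_exp_decay {𝔸 : Type*} [NormedRing 𝔸]
    {f : ℝ → 𝔸} {b k x : ℝ} (hk : 0 < k) (hc : Continuous f)
    (hf : ∀ y, x ≤ y → ‖f y‖ ≤ b * Real.exp (-k * y)) :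
    MeasureTheory.IntegrableOn f (Ioi x) :=
  MeasureTheory.Integrable.mono'
    ((integrableOn_exp_mul_Ioi (neg_neg_of_pos hk) x).const_mul b)
    hc.aestronglyMeasurable
    (by filter_upwards [MeasureTheory.ae_restrict_mem measurableSet_Ioi] with y hy
        exact hf y (le_of_lt hy))

/-- A linear equation `Z' = N Z` with exponentially small coefficient has a solution tending to
`1` at `+∞`: the fixed point of `Z ↦ 1 - ∫_x^∞ N Z`. -/
theorem exists_solution_tendsto_one {𝔸 : Type*} [NormedRing 𝔸] [NormedAlgebra ℝ 𝔸]
    [CompleteSpace 𝔸] [NormOneClass 𝔸] {N : ℝ → 𝔸} {c k : ℝ} (hN : Continuous N)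
    (hc : 0 ≤ c) (hk : 0 < k) (hck : 2 * c ≤ k)
    (hNle : ∀ x, 0 ≤ x → ‖N x‖ ≤ c * Real.exp (-k * x)) :
    ∃ Z : ℝ → 𝔸, ∀ x, 0 ≤ x → HasDerivWithinAt Z (N x * Z x) (Ici 0) x ∧
      ‖Z x - 1‖ ≤ 2 * c / k * Real.exp (-k * x) := by
  classical
  have hck' : c / k ≤ 1 / 2 := by rw [div_le_iff₀ hk]; linarith
  have hbd : ∀ (Z : BoundedContinuousFunction ℝ 𝔸) (y : ℝ), 0 ≤ y →
      ‖N y * Z y‖ ≤ (c * ‖Z‖) * Real.exp (-k * y) := fun Z y hy => by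
    calc ‖N y * Z y‖ ≤ ‖N y‖ * ‖Z y‖ := norm_mul_le _ _
      _ ≤ (c * Real.exp (-k * y)) * ‖Z‖ := by
          gcongr
          exacts [hNle y hy, Z.norm_coe_le_norm y]
      _ = _ := by ring
  have hcont : ∀ Z : BoundedContinuousFunction ℝ 𝔸, Continuous fun y => N y * Z y :=
    fun Z => hN.mul Z.continuous
  have hint : ∀ (Z : BoundedContinuousFunction ℝ 𝔸) (x : ℝ), 0 ≤ x →
      MeasureTheory.IntegrableOn (fun y => N y * Z y) (Ioi x) := fun Z x hx =>
    integrableOn_Ioi_of_exp_decay hk (hcont Z) fun y hy => hbd Z y (hx.trans hy)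
  have hsplit : ∀ (Z : BoundedContinuousFunction ℝ 𝔸) (x : ℝ), 0 ≤ x →
      ∫ y in Ioi x, N y * Z y = (∫ y in Ioi 0, N y * Z y) - ∫ y in (0 : ℝ)..x, N y * Z y :=
    fun Z x hx => by
      rw [← intervalIntegral.integral_interval_add_Ioi (hint Z 0 le_rfl) (hint Z x hx)]
      abel
  have hT : ∀ (Z : BoundedContinuousFunction ℝ 𝔸) (x : ℝ),
      ‖∫ y in Ioi (max x 0), N y * Z y‖ ≤ c * ‖Z‖ / k := fun Z x => by
    refine (norm_integral_Ioi_le_exp hk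
      fun y hy => hbd Z y ((le_max_right x 0).trans hy)).trans ?_
    refine mul_le_of_le_one_right (by positivity) (Real.exp_le_one_iff.2 ?_)
    nlinarith [le_max_right x 0]
  let T : BoundedContinuousFunction ℝ 𝔸 → BoundedContinuousFunction ℝ 𝔸 := fun Z =>
    BoundedContinuousFunction.ofNormedAddCommGroup
      (fun x => 1 - ∫ y in Ioi (max x 0), N y * Z y)
      (by
        have : (fun x => 1 - ∫ y in Ioi (max x 0), N y * Z y) = fun x =>
            1 - ((∫ y in Ioi 0, N y * Z y) - ∫ y in (0 : ℝ)..(max x 0), N y * Z y) := by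
          funext x
          rw [hsplit Z _ (le_max_right x 0)]
        rw [this]
        have h1 := intervalIntegral.continuous_primitive (μ := MeasureTheory.volume)
          (fun a b => (hcont Z).intervalIntegrable a b) 0
        exact continuous_const.sub (continuous_const.sub
          (h1.comp (continuous_id.max continuous_const))))
      (1 + c * ‖Z‖ / k)
      (fun x => (norm_sub_le _ _).trans (by rw [norm_one]; gcongr; exact hT Z x))
  have hTapp : ∀ Z x, T Z x = 1 - ∫ y in Ioi (max x 0), N y * Z y := fun Z x => rfl
  have hcontr : ContractingWith (1 / 2) T := by
    refine ⟨by rw [← NNReal.coe_lt_coe]; norm_num, LipschitzWith.of_dist_le_mul fun Z W => ?_⟩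
    rw [BoundedContinuousFunction.dist_le (by positivity)]
    intro x
    have h1 : T W x - T Z x = ∫ y in Ioi (max x 0), N y * (Z - W) y := by
      have : ∀ y, N y * (Z - W) y = N y * Z y - N y * W y := fun y => by
        rw [BoundedContinuousFunction.sub_apply, mul_sub]
      simp_rw [this]
      rw [MeasureTheory.integral_sub (hint Z _ (le_max_right x 0)) (hint W _ (le_max_right x 0)),
        hTapp, hTapp]
      abel
    rw [dist_comm, dist_eq_norm, h1, dist_eq_norm]
    refine (hT (Z - W) x).trans ?_
    rw [mul_div_right_comm]
    gcongr
    simpa using hck'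
  obtain ⟨Z, hZ⟩ : ∃ Z, T Z = Z := ⟨_, hcontr.fixedPoint_isFixedPt⟩
  have hZnorm : ‖Z‖ ≤ 2 := by
    have h1 : ‖Z‖ ≤ 1 + c * ‖Z‖ / k := by
      rw [BoundedContinuousFunction.norm_le (by positivity)]
      intro x
      have h2 : Z x = T Z x := by rw [hZ]
      rw [h2, hTapp]
      exact (norm_sub_le _ _).trans (by rw [norm_one]; gcongr; exact hT Z x)
    have h2 : c * ‖Z‖ / k ≤ 1 / 2 * ‖Z‖ := by rw [mul_div_right_comm]; gcongr
    linarith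
  have hZeq : ∀ x, 0 ≤ x → Z x = 1 - ∫ y in Ioi x, N y * Z y := fun x hx => by
    conv_lhs => rw [← hZ, hTapp, max_eq_left hx]
  refine ⟨Z, fun x hx => ⟨?_, ?_⟩⟩
  · have h1 : HasDerivAt (fun u => ∫ y in (0 : ℝ)..u, N y * Z y) (N x * Z x) x :=
      intervalIntegral.integral_hasDerivAt_right ((hcont Z).intervalIntegrable _ _)
        ((hcont Z).stronglyMeasurableAtFilter _ _) (hcont Z).continuousAt
    have h2 : HasDerivAt (fun u => 1 - ((∫ y in Ioi 0, N y * Z y) -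
        ∫ y in (0 : ℝ)..u, N y * Z y)) (N x * Z x) x :=
      ((h1.const_sub _).const_sub 1).congr_deriv (by simp)
    refine h2.hasDerivWithinAt.congr (fun y hy => ?_) ?_
    · rw [hZeq y hy, hsplit Z y hy]
    · rw [hZeq x hx, hsplit Z x hx]
  · rw [hZeq x hx, sub_sub_cancel_left, norm_neg]
    refine (norm_integral_Ioi_le_exp hk fun y hy => hbd Z y (hx.trans hy)).trans ?_
    have : c * ‖Z‖ ≤ 2 * c := by nlinarith
    gcongr

/-- If the coefficient converges to its limit at an exponential rate beyond four times the norm of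
the limit, then a conjugator exists, and it is close to the identity when the rate is large. In the
unknown `Z = e^{-x A∞} P e^{x A∞}` the equation for the conjugator has an exponentially small
coefficient. -/
theorem exists_conjugator {𝔸 : Type*} [NormedRing 𝔸] [NormedAlgebra ℝ 𝔸] [CompleteSpace 𝔸]
    [NormOneClass 𝔸] {A : ℝ → 𝔸} {Ainf : 𝔸} {M c κ : ℝ} (hA : Continuous A)
    (hM : ‖Ainf‖ ≤ M) (hc : 0 ≤ c) (hκ : 2 * M < κ - 2 * M) (hcκ : 4 * c ≤ κ - 2 * M)
    (hdec : ∀ x, 0 ≤ x → ‖A x - Ainf‖ ≤ c * Real.exp (-κ * x)) :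
    ∃ P : ℝ → 𝔸, ∀ x, 0 ≤ x →
      HasDerivWithinAt P (A x * P x - P x * Ainf) (Ici 0) x ∧ IsUnit (P x) ∧
      ‖P x - 1‖ ≤ 2 * c / (κ - 2 * M) * Real.exp (-(κ - 4 * M) * x) := by
  have hM0 : 0 ≤ M := (norm_nonneg _).trans hM
  have hk : 0 < κ - 2 * M := by linarith
  set E : ℝ → 𝔸 := fun x => NormedSpace.exp (x • Ainf)
  set F : ℝ → 𝔸 := fun x => NormedSpace.exp ((-x) • Ainf)
  have hEF : ∀ x, E x * F x = 1 := exp_smul_mul_exp_neg_smul Ainf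
  have hFE : ∀ x, F x * E x = 1 := exp_neg_smul_mul_exp_smul Ainf
  have hE' : ∀ x, HasDerivAt E (Ainf * E x) x := hasDerivAt_exp_smul_const' Ainf
  have hF' : ∀ x, HasDerivAt F (-(F x * Ainf)) x := hasDerivAt_exp_neg_smul Ainf
  have hEc : Continuous E := continuous_iff_continuousAt.2 fun x => (hE' x).continuousAt
  have hFc : Continuous F := continuous_iff_continuousAt.2 fun x => (hF' x).continuousAt
  have hEn : ∀ x, 0 ≤ x → ‖E x‖ ≤ Real.exp (M * x) := fun x hx => by
    refine (norm_exp_smul_le Ainf x).trans ?_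
    rw [abs_of_nonneg hx, mul_comm]
    gcongr
  have hFn : ∀ x, 0 ≤ x → ‖F x‖ ≤ Real.exp (M * x) := fun x hx => by
    refine (norm_exp_smul_le Ainf (-x)).trans ?_
    rw [abs_neg, abs_of_nonneg hx, mul_comm]
    gcongr
  -- Conjugation by `e^{± x A∞}` costs a factor `e^{2 M x}`. It occurs twice: in the coefficient of
  -- the equation for `Z`, and in the return from `Z` to `P`.
  have hsand : ∀ (G H X : 𝔸) (x b l : ℝ), ‖G‖ ≤ Real.exp (M * x) → ‖H‖ ≤ Real.exp (M * x) →
      ‖X‖ ≤ b * Real.exp (-l * x) → ‖G * X * H‖ ≤ b * Real.exp (-(l - 2 * M) * x) := by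
    intro G H X x b l hG hH hX
    calc ‖G * X * H‖ ≤ ‖G‖ * ‖X‖ * ‖H‖ := norm_mul₃_le
      _ ≤ Real.exp (M * x) * (b * Real.exp (-l * x)) * Real.exp (M * x) := by
          have : 0 ≤ b * Real.exp (-l * x) := (norm_nonneg _).trans hX
          gcongr
      _ = b * (Real.exp (M * x) * Real.exp (-l * x) * Real.exp (M * x)) := by ring
      _ = _ := by rw [← Real.exp_add, ← Real.exp_add]; ring_nf
  obtain ⟨Z, hZ⟩ := exists_solution_tendsto_one (N := fun x => F x * (A x - Ainf) * E x)
    (c := c) (k := κ - 2 * M) ((hFc.mul (hA.sub continuous_const)).mul hEc) hc hk (by linarith)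
    (fun x hx => hsand _ _ _ _ _ _ (hFn x hx) (hEn x hx) (hdec x hx))
  refine ⟨fun x => E x * Z x * F x, fun x hx => ⟨?_, ?_, ?_⟩⟩
  · refine (((hE' x).hasDerivWithinAt.mul (hZ x hx).1).mul (hF' x).hasDerivWithinAt).congr_deriv ?_
    have h1 : E x * (F x * (A x - Ainf) * E x * Z x) = (A x - Ainf) * (E x * Z x) := by
      rw [show E x * (F x * (A x - Ainf) * E x * Z x) =
        (E x * F x) * ((A x - Ainf) * (E x * Z x)) by simp only [mul_assoc], hEF, one_mul]
    simp only [Pi.mul_apply]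
    rw [h1]
    noncomm_ring
  · have h1 : ‖1 - Z x‖ < 1 := by
      rw [norm_sub_rev]
      refine (hZ x hx).2.trans_lt ?_
      have h2 : 2 * c / (κ - 2 * M) ≤ 1 / 2 := by rw [div_le_iff₀ hk]; linarith
      have h3 : Real.exp (-(κ - 2 * M) * x) ≤ 1 := Real.exp_le_one_iff.2 (by nlinarith)
      have h4 := Real.exp_pos (-(κ - 2 * M) * x)
      nlinarith
    have h2 : IsUnit (Z x) := by simpa using isUnit_one_sub_of_norm_lt_one h1
    exact (IsUnit.mul ⟨⟨E x, F x, hEF x, hFE x⟩, rfl⟩ h2).mul ⟨⟨F x, E x, hFE x, hEF x⟩, rfl⟩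
  · have h1 : E x * Z x * F x - 1 = E x * (Z x - 1) * F x := by
      rw [mul_sub, sub_mul, mul_one, hEF]
    rw [h1]
    refine (hsand _ _ _ _ _ _ (hEn x hx) (hFn x hx) (hZ x hx).2).trans_eq ?_
    ring_nf

/-! ### Bivectors and the uniqueness of the determinant -/

section Wedge
open scoped Matrix.Norms.Operator

/-- The bivector `R₁ ∧ R₂` of the two columns of `R`, as an antisymmetric matrix. -/
def bivector (R : Matrix (Fin 4) (Fin 2) ℂ) : Matrix (Fin 4) (Fin 4) ℂ :=
  R * (!![0, 1; -1, 0] : Matrix (Fin 2) (Fin 2) ℂ) * R.transpose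

theorem bivector_transpose (R : Matrix (Fin 4) (Fin 2) ℂ) :
    (bivector R).transpose = -bivector R := by
  have : (!![0, 1; -1, 0] : Matrix (Fin 2) (Fin 2) ℂ).transpose = -!![0, 1; -1, 0] := by
    ext i j; fin_cases i <;> fin_cases j <;> simp
  rw [bivector, Matrix.transpose_mul, Matrix.transpose_mul, this, Matrix.transpose_transpose,
    Matrix.neg_mul, Matrix.mul_neg, Matrix.mul_assoc]

theorem bivector_mul (P : Matrix (Fin 4) (Fin 4) ℂ) (R : Matrix (Fin 4) (Fin 2) ℂ) :
    bivector (P * R) = P * bivector R * P.transpose := by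
  simp only [bivector, Matrix.transpose_mul, Matrix.mul_assoc]

theorem bivector_apply (R : Matrix (Fin 4) (Fin 2) ℂ) (i j : Fin 4) :
    bivector R i j = R i 0 * R j 1 - R i 1 * R j 0 := by
  simp [bivector, Matrix.mul_apply, Fin.sum_univ_two]
  ring

theorem detCols_eq (X Y : Matrix (Fin 4) (Fin 2) ℂ) :
    detCols X Y = bivector X 0 1 * bivector Y 2 3 - bivector X 0 2 * bivector Y 1 3 +
      bivector X 0 3 * bivector Y 1 2 + bivector X 1 2 * bivector Y 0 3 -
      bivector X 1 3 * bivector Y 0 2 + bivector X 2 3 * bivector Y 0 1 := by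
  simp only [bivector_apply]
  rw [detCols, Matrix.det_succ_row_zero]
  simp [Fin.sum_univ_succ, Matrix.det_fin_three, Fin.succAbove]
  ring

theorem detCols_congr {X X' Y Y' : Matrix (Fin 4) (Fin 2) ℂ} (hX : bivector X = bivector X')
    (hY : bivector Y = bivector Y') : detCols X Y = detCols X' Y' := by
  rw [detCols_eq, detCols_eq, hX, hY]

/-- The action `X ↦ A X + X Aᵀ` of `A` on matrices; on antisymmetric matrices it is the action of
`A` on bivectors, as a derivation. -/
def bivectorAction (A : Matrix (Fin 4) (Fin 4) ℂ) :
    Module.End ℂ (Matrix (Fin 4) (Fin 4) ℂ) :=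
  LinearMap.mulLeft ℂ A + LinearMap.mulRight ℂ A.transpose

@[simp] theorem bivectorAction_apply (A X : Matrix (Fin 4) (Fin 4) ℂ) :
    bivectorAction A X = A * X + X * A.transpose := by
  simp [bivectorAction]

/-- `η` is an eigenvector of the action of `A` on bivectors (or zero), for an eigenvalue whose
real part is the least one. The bivector of a basis of the stable subspace is of this kind, and,
unlike the property of being such a basis, this passes to limits in which the splitting degenerates.
-/
def IsLeastBivector (A η : Matrix (Fin 4) (Fin 4) ℂ) : Prop :=
  ∃ τ : ℂ, bivectorAction A η = τ • η ∧ ∀ (β : ℂ) (ω : Matrix (Fin 4) (Fin 4) ℂ),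
    ω.transpose = -ω → ω ≠ 0 → bivectorAction A ω = β • ω → τ.re ≤ β.re

theorem norm_le_of_entries_le {X : Matrix (Fin 4) (Fin 4) ℂ} {b : ℝ} (h : ∀ i j, ‖X i j‖ ≤ b) :
    ‖X‖ ≤ 4 * b := by
  have hb : 0 ≤ b := (norm_nonneg _).trans (h 0 0)
  lift b to NNReal using hb
  rw [Matrix.linfty_opNorm_def]
  norm_cast
  refine Finset.sup_le fun i _ => ?_
  refine (Finset.sum_le_sum fun j _ => (show ‖X i j‖₊ ≤ b from h i j)).trans ?_
  simp

theorem entry_norm_le (X : Matrix (Fin 4) (Fin 4) ℂ) (i j : Fin 4) : ‖X i j‖ ≤ ‖X‖ := by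
  rw [Matrix.linfty_opNorm_def, ← coe_nnnorm, NNReal.coe_le_coe]
  exact (Finset.single_le_sum (f := fun j => ‖X i j‖₊) (fun _ _ => zero_le)
    (Finset.mem_univ j)).trans
    (Finset.le_sup (f := fun i => ∑ j, ‖X i j‖₊) (Finset.mem_univ i))

theorem norm_transpose_le (X : Matrix (Fin 4) (Fin 4) ℂ) : ‖X.transpose‖ ≤ 4 * ‖X‖ :=
  norm_le_of_entries_le fun i j => entry_norm_le X j i

theorem hasDerivAt_transpose {f : ℝ → Matrix (Fin 4) (Fin 4) ℂ} {f' : Matrix (Fin 4) (Fin 4) ℂ}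
    {x : ℝ} (h : HasDerivAt f f' x) : HasDerivAt (fun x => (f x).transpose) f'.transpose x := by
  let T : Matrix (Fin 4) (Fin 4) ℂ →L[ℝ] Matrix (Fin 4) (Fin 4) ℂ :=
    LinearMap.toContinuousLinearMap (Matrix.transposeLinearEquiv (Fin 4) (Fin 4) ℝ ℂ).toLinearMap
  exact T.hasFDerivAt.comp_hasDerivAt x h

theorem commute_exp_smul (A : Matrix (Fin 4) (Fin 4) ℂ) (x : ℝ) :
    A * NormedSpace.exp (x • A) = NormedSpace.exp (x • A) * A := by
  have h1 := hasDerivAt_exp_smul_const A x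
  exact (hasDerivAt_exp_smul_const' A x).unique h1

/-- Along the flow of `A`, an eigenvector of the action on bivectors is multiplied by a scalar
exponential. -/
theorem exp_mul_mul_exp_transpose {A ω : Matrix (Fin 4) (Fin 4) ℂ} {β : ℂ}
    (h : bivectorAction A ω = β • ω) (x : ℝ) :
    NormedSpace.exp (x • A) * ω * (NormedSpace.exp (x • A)).transpose =
      Complex.exp (β * x) • ω := by
  set E : ℝ → Matrix (Fin 4) (Fin 4) ℂ := fun x => NormedSpace.exp (x • A)
  have hE : ∀ x, HasDerivAt E (A * E x) x := hasDerivAt_exp_smul_const' A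
  have hAE : ∀ x, A * E x = E x * A := commute_exp_smul A
  have hc : ∀ x : ℝ, HasDerivAt (fun x : ℝ => Complex.exp (-β * x)) (Complex.exp (-β * x) * -β) x :=
    fun x => by
      have h1 : HasDerivAt (fun x : ℝ => -β * (x : ℂ)) (-β) x := by
        simpa using (Complex.ofRealCLM.hasDerivAt (x := x)).const_mul (-β)
      exact h1.cexp
  set G : ℝ → Matrix (Fin 4) (Fin 4) ℂ := fun x =>
    Complex.exp (-β * x) • (E x * ω * (E x).transpose)
  have hG : ∀ x, HasDerivAt G 0 x := fun x => by
    refine ((hc x).fun_smul (((hE x).mul_const ω).mul (hasDerivAt_transpose (hE x)))).congr_deriv ?_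
    have h2 : A * E x * ω * (E x).transpose + E x * ω * (A * E x).transpose =
        β • (E x * ω * (E x).transpose) := by
      calc _ = E x * (bivectorAction A ω) * (E x).transpose := by
            rw [hAE, Matrix.transpose_mul, bivectorAction_apply]
            noncomm_ring
        _ = _ := by rw [h, Matrix.mul_smul, Matrix.smul_mul]
    rw [h2, smul_smul, Pi.mul_apply, ← add_smul]
    simp
  have h3 : G x = G 0 := is_const_of_deriv_eq_zero (fun x => (hG x).differentiableAt)
    (fun x => (hG x).deriv) x 0
  have h4 : G 0 = ω := by simp [G, E]
  rw [h4] at h3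
  conv_rhs => rw [← h3]
  simp only [G, smul_smul]
  rw [← Complex.exp_add]
  simp [E]

/-- The solutions `P e^{x A∞}` given by two conjugators differ by a constant right factor. -/
theorem IsConjugator.mul_exp_eq {A : ℝ → Matrix (Fin 4) (Fin 4) ℂ} (hA : Continuous A)
    {Ainf : Matrix (Fin 4) (Fin 4) ℂ} {P Q : ℝ → Matrix (Fin 4) (Fin 4) ℂ}
    (hP : IsConjugator A Ainf (Ici 0) P) (hQ : IsConjugator A Ainf (Ici 0) Q)
    {S : Matrix (Fin 4) (Fin 4) ℂ} (hS : P 0 * S = Q 0) {x : ℝ} (hx : 0 ≤ x) :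
    P x * NormedSpace.exp (x • Ainf) * S = Q x * NormedSpace.exp (x • Ainf) := by
  have hE : ∀ x, HasDerivAt (fun x : ℝ => NormedSpace.exp (x • Ainf))
    (Ainf * NormedSpace.exp (x • Ainf)) x := hasDerivAt_exp_smul_const' Ainf
  have hW : ∀ P, IsConjugator A Ainf (Ici 0) P → ∀ x ∈ Ici (0 : ℝ),
      HasDerivWithinAt (fun x => P x * NormedSpace.exp (x • Ainf))
        (A x * (P x * NormedSpace.exp (x • Ainf))) (Ici 0) x := fun P hP x hx => by
    refine ((hP.ode x hx).mul (hE x).hasDerivWithinAt).congr_deriv ?_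
    noncomm_ring
  obtain ⟨K, hK⟩ := (isCompact_Icc (a := (0 : ℝ)) (b := x)).bddAbove_image hA.norm.continuousOn
  have hK0 : 0 ≤ K := (norm_nonneg _).trans (hK ⟨0, ⟨le_rfl, hx⟩, rfl⟩)
  have hV1 : ∀ x ∈ Ici (0 : ℝ), HasDerivWithinAt (fun x => P x * NormedSpace.exp (x • Ainf) * S)
      (A x * (P x * NormedSpace.exp (x • Ainf) * S)) (Ici 0) x := fun x hx => by
    refine ((hW P hP x hx).mul_const S).congr_deriv ?_
    simp only [mul_assoc]
  refine ODE_solution_unique_of_mem_Icc_right (v := fun t W => A t * W) (s := fun _ => univ)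
    (K := ⟨K, hK0⟩) (a := 0) (b := x)
    (f := fun x => P x * NormedSpace.exp (x • Ainf) * S)
    (g := fun x => Q x * NormedSpace.exp (x • Ainf))
    (fun t ht => ?_)
    (fun t ht => ((hV1 t ht.1).continuousWithinAt).mono Icc_subset_Ici_self)
    (fun t ht => (hV1 t ht.1).mono (Ici_subset_Ici.2 ht.1)) (fun _ _ => mem_univ _)
    (fun t ht => ((hW Q hQ t ht.1).continuousWithinAt).mono Icc_subset_Ici_self)
    (fun t ht => (hW Q hQ t ht.1).mono (Ici_subset_Ici.2 ht.1)) (fun _ _ => mem_univ _)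
    (by simp [hS]) (right_mem_Icc.2 hx)
  refine (LipschitzWith.of_dist_le_mul fun X Y => ?_).lipschitzOnWith
  rw [dist_eq_norm, dist_eq_norm, ← mul_sub]
  refine (norm_mul_le _ _).trans ?_
  gcongr
  exact hK ⟨t, ⟨ht.1, ht.2.le⟩, rfl⟩

theorem IsConjugator.isBigO_sub_one {A : ℝ → Matrix (Fin 4) (Fin 4) ℂ}
    {Ainf : Matrix (Fin 4) (Fin 4) ℂ} {P : ℝ → Matrix (Fin 4) (Fin 4) ℂ}
    (hP : IsConjugator A Ainf (Ici 0) P) :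
    ∃ θ : ℝ, 0 < θ ∧ (fun x => P x - 1) =O[atTop] fun x => Real.exp (-θ * x) := by
  obtain ⟨C, θ, hθ, h⟩ := hP.decay
  refine ⟨θ, hθ, Asymptotics.IsBigO.of_bound (4 * C) ?_⟩
  filter_upwards [eventually_ge_atTop 0] with x hx
  rw [Real.norm_eq_abs, Real.abs_exp, mul_assoc]
  refine norm_le_of_entries_le fun i j => ?_
  simpa [abs_of_nonneg hx] using h x hx i j

theorem isBigO_exp_neg_of_le {θ θ' : ℝ} (h : θ' ≤ θ) :
    (fun x => Real.exp (-θ * x)) =O[atTop] fun x => Real.exp (-θ' * x) := by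
  refine Asymptotics.IsBigO.of_bound 1 ?_
  filter_upwards [eventually_ge_atTop 0] with x hx
  rw [Real.norm_eq_abs, Real.norm_eq_abs, Real.abs_exp, Real.abs_exp, one_mul]
  exact Real.exp_le_exp.2 (by nlinarith)

/-- The bivectors that decay, relative to `e^{τ x}`, exponentially under the flow of `A` form an
invariant subspace of the action of `A`. If the eigenvalues of this action have real part at least
`Re τ`, it contains no eigenvector, hence is trivial. -/
theorem eq_zero_of_isBigO_exp {A u : Matrix (Fin 4) (Fin 4) ℂ} {t θ : ℝ} (hθ : 0 < θ)
    (hleast : ∀ (β : ℂ) (ω : Matrix (Fin 4) (Fin 4) ℂ),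
      ω.transpose = -ω → ω ≠ 0 → bivectorAction A ω = β • ω → t ≤ β.re)
    (hu : u.transpose = -u)
    (hO : (fun x : ℝ => NormedSpace.exp (x • A) * u * (NormedSpace.exp (x • A)).transpose)
      =O[atTop] fun x => Real.exp ((t - θ) * x)) : u = 0 := by
  set E : ℝ → Matrix (Fin 4) (Fin 4) ℂ := fun x => NormedSpace.exp (x • A)
  have hAE : ∀ x, A * E x = E x * A := commute_exp_smul A
  let U : Submodule ℂ (Matrix (Fin 4) (Fin 4) ℂ) :=
    { carrier := {u | u.transpose = -u ∧ (fun x : ℝ => E x * u * (E x).transpose)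
        =O[atTop] fun x => Real.exp ((t - θ) * x)}
      add_mem' := fun {a b} ha hb => by
        refine ⟨by rw [Matrix.transpose_add, ha.1, hb.1, neg_add], ?_⟩
        simpa only [mul_add, add_mul] using ha.2.add hb.2
      zero_mem' := ⟨by simp, by simpa using Asymptotics.isBigO_zero _ _⟩
      smul_mem' := fun c a ha => by
        refine ⟨by rw [Matrix.transpose_smul, ha.1, smul_neg], ?_⟩
        refine (ha.2.const_smul_left c).congr_left fun x => ?_
        rw [Pi.smul_apply, Matrix.mul_smul, Matrix.smul_mul] }
  have hU : ∀ a ∈ U, bivectorAction A a ∈ U := fun a ha => by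
    refine ⟨?_, ?_⟩
    · rw [bivectorAction_apply, Matrix.transpose_add, Matrix.transpose_mul, Matrix.transpose_mul,
        Matrix.transpose_transpose, ha.1, neg_mul, mul_neg, ← neg_add, add_comm]
    · have h1 : ∀ x, E x * (bivectorAction A a) * (E x).transpose =
          A * (E x * a * (E x).transpose) + (E x * a * (E x).transpose) * A.transpose := fun x => by
        have h2 : A.transpose * (E x).transpose = (E x).transpose * A.transpose := by
          rw [← Matrix.transpose_mul, ← Matrix.transpose_mul, hAE]
        rw [bivectorAction_apply, mul_add, add_mul]
        congr 1
        · simp only [← mul_assoc, hAE]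
        · simp only [mul_assoc, h2]
      simp_rw [h1]
      have h3 : ∀ B : Matrix (Fin 4) (Fin 4) ℂ, (fun _ : ℝ => B) =O[atTop] fun _ => (1 : ℝ) :=
        fun B => Asymptotics.isBigO_const_const _ one_ne_zero _
      refine Asymptotics.IsBigO.add ?_ ?_
      · simpa using (h3 A).mul ha.2
      · simpa using ha.2.mul (h3 A.transpose)
  by_contra hne
  have : Nontrivial U := ⟨⟨⟨u, hu, hO⟩, 0, fun h => hne (congrArg Subtype.val h)⟩⟩
  obtain ⟨β, hβ⟩ := Module.End.exists_eigenvalue ((bivectorAction A).restrict hU)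
  obtain ⟨⟨ω, hω⟩, hωβ, hω0⟩ := hβ.exists_hasEigenvector
  have hω0' : ω ≠ 0 := fun h => hω0 (Subtype.ext h)
  have heig : bivectorAction A ω = β • ω := by
    have := congrArg Subtype.val (Module.End.mem_eigenspace_iff.1 hωβ)
    simpa using this
  have hle := hleast β ω hω.1 hω0' heig
  obtain ⟨C, hC⟩ := hω.2.bound
  have hlim : Tendsto (fun x : ℝ => Real.exp (θ * x) * ‖ω‖) atTop atTop :=
    (Real.tendsto_exp_atTop.comp (tendsto_id.const_mul_atTop hθ)).atTop_mul_const
      (norm_pos_iff.2 hω0')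
  obtain ⟨x, hx1, hx2, hx3⟩ := (hC.and ((eventually_ge_atTop 0).and
    (hlim.eventually_gt_atTop C))).exists
  rw [show E x * ω * (E x).transpose = Complex.exp (β * x) • ω from
    exp_mul_mul_exp_transpose heig x, norm_smul, Complex.norm_exp, Real.norm_eq_abs,
    Real.abs_exp] at hx1
  have h5 : (β * x).re = β.re * x := by simp
  rw [h5] at hx1
  have h6 : Real.exp (t * x) * ‖ω‖ ≤ C * Real.exp ((t - θ) * x) := by
    refine le_trans ?_ hx1
    gcongr
  have h7 : Real.exp (t * x) = Real.exp (θ * x) * Real.exp ((t - θ) * x) := by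
    rw [← Real.exp_add]; ring_nf
  rw [h7] at h6
  have := Real.exp_pos ((t - θ) * x)
  nlinarith

/-- Conjugators are not unique, but their action on a least bivector is. -/
theorem IsConjugator.bivector_unique {A : ℝ → Matrix (Fin 4) (Fin 4) ℂ} (hA : Continuous A)
    {Ainf : Matrix (Fin 4) (Fin 4) ℂ} {P Q : ℝ → Matrix (Fin 4) (Fin 4) ℂ}
    (hP : IsConjugator A Ainf (Ici 0) P) (hQ : IsConjugator A Ainf (Ici 0) Q)
    {η : Matrix (Fin 4) (Fin 4) ℂ} (hη : η.transpose = -η) (hleast : IsLeastBivector Ainf η) :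
    P 0 * η * (P 0).transpose = Q 0 * η * (Q 0).transpose := by
  obtain ⟨τ, hτ, hle⟩ := hleast
  have hdet : IsUnit (P 0).det := (Matrix.isUnit_iff_isUnit_det _).1 (hP.isUnit 0 self_mem_Ici)
  set S : Matrix (Fin 4) (Fin 4) ℂ := (P 0)⁻¹ * Q 0
  have hS : P 0 * S = Q 0 := Matrix.mul_nonsing_inv_cancel_left _ _ hdet
  set E : ℝ → Matrix (Fin 4) (Fin 4) ℂ := fun x => NormedSpace.exp (x • Ainf)
  set F : ℝ → Matrix (Fin 4) (Fin 4) ℂ := fun x => NormedSpace.exp ((-x) • Ainf)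
  have hEF : ∀ x, E x * F x = 1 := exp_smul_mul_exp_neg_smul Ainf
  have hFE : ∀ x, F x * E x = 1 := exp_neg_smul_mul_exp_smul Ainf
  set D : ℝ → Matrix (Fin 4) (Fin 4) ℂ := fun x => E x * S * F x - 1
  have hPD : ∀ x, 0 ≤ x → P x * D x = (Q x - 1) - (P x - 1) := fun x hx => by
    have h1 : P x * E x * S = Q x * E x := hP.mul_exp_eq hA hQ hS hx
    calc P x * D x = P x * E x * S * F x - P x := by simp only [D]; noncomm_ring
      _ = Q x * (E x * F x) - P x := by rw [h1, mul_assoc]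
      _ = _ := by rw [hEF]; noncomm_ring
  obtain ⟨θ₁, hθ₁, hO₁⟩ := hP.isBigO_sub_one
  obtain ⟨θ₂, hθ₂, hO₂⟩ := hQ.isBigO_sub_one
  set θ := min θ₁ θ₂
  have hθ : 0 < θ := lt_min hθ₁ hθ₂
  have hO₁' := hO₁.trans (isBigO_exp_neg_of_le (min_le_left θ₁ θ₂))
  have hO₂' := hO₂.trans (isBigO_exp_neg_of_le (min_le_right θ₁ θ₂))
  have hexp0 : ∀ θ : ℝ, 0 < θ → Tendsto (fun x : ℝ => Real.exp (-θ * x)) atTop (𝓝 0) :=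
    fun θ hθ => Real.tendsto_exp_atBot.comp
      (tendsto_id.const_mul_atTop_of_neg (neg_neg_of_pos hθ))
  have hPlim : Tendsto (fun x => P x - 1) atTop (𝓝 0) := hO₁.trans_tendsto (hexp0 _ hθ₁)
  -- `‖P - 1‖ ≤ 1 / 2` lets `D` be estimated by `P D = Q - P`, without the inverse of `P`.
  have hD : D =O[atTop] fun x => Real.exp (-θ * x) := by
    refine Asymptotics.IsBigO.trans (Asymptotics.IsBigO.of_bound 2 ?_) (hO₂'.sub hO₁')
    filter_upwards [eventually_ge_atTop 0,
      hPlim.norm.eventually (gt_mem_nhds (show ‖(0 : Matrix (Fin 4) (Fin 4) ℂ)‖ < 1 / 2 by simp))]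
      with x hx hx2
    rw [← hPD x hx]
    have h1 : D x = P x * D x - (P x - 1) * D x := by noncomm_ring
    have h2 : ‖D x‖ ≤ ‖P x * D x‖ + ‖P x - 1‖ * ‖D x‖ := by
      conv_lhs => rw [h1]
      exact (norm_sub_le _ _).trans (by gcongr; exact norm_mul_le _ _)
    nlinarith [norm_nonneg (D x)]
  have hD0 : D =O[atTop] fun _ => (1 : ℝ) := hD.trans
    ((hexp0 θ hθ).isBigO_one ℝ)
  have hDt : (fun x => (D x).transpose) =O[atTop] fun x => Real.exp (-θ * x) :=
    (Asymptotics.IsBigO.of_bound 4 (Eventually.of_forall fun x => norm_transpose_le _)).trans hD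
  have hηO : (fun _ : ℝ => η) =O[atTop] fun _ => (1 : ℝ) :=
    Asymptotics.isBigO_const_const _ one_ne_zero _
  set u := S * η * S.transpose - η
  have hu : u.transpose = -u := by
    simp only [u, Matrix.transpose_sub, Matrix.transpose_mul, Matrix.transpose_transpose, hη]
    noncomm_ring
  have hEu : ∀ x, E x * u * (E x).transpose =
      Complex.exp (τ * x) • (D x * η + η * (D x).transpose + D x * η * (D x).transpose) :=
    fun x => by
    have h1 : E x * η * (E x).transpose = Complex.exp (τ * x) • η :=
      exp_mul_mul_exp_transpose hτ x
    have hDE : (D x + 1) * E x = E x * S := by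
      simp only [D, sub_add_cancel]
      rw [mul_assoc, hFE, mul_one]
    have hDE' : (E x).transpose * ((D x).transpose + 1) = S.transpose * (E x).transpose := by
      rw [← Matrix.transpose_mul, ← hDE, Matrix.transpose_mul, Matrix.transpose_add,
        Matrix.transpose_one]
    calc E x * u * (E x).transpose
        = (E x * S) * η * (S.transpose * (E x).transpose) - E x * η * (E x).transpose := by
          simp only [u]; noncomm_ring
      _ = (D x + 1) * (E x * η * (E x).transpose) * ((D x).transpose + 1)
          - E x * η * (E x).transpose := by
          rw [← hDE, ← hDE']; noncomm_ring
      _ = _ := by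
          rw [h1, Matrix.mul_smul, Matrix.smul_mul, ← smul_sub]
          congr 1
          noncomm_ring
  have hu0 : u = 0 := by
    refine eq_zero_of_isBigO_exp hθ hle hu ?_
    have hO : (fun x => D x * η + η * (D x).transpose + D x * η * (D x).transpose) =O[atTop]
        fun x => Real.exp (-θ * x) := by
      refine Asymptotics.IsBigO.add (Asymptotics.IsBigO.add ?_ ?_) ?_
      · simpa using hD.mul hηO
      · simpa using hηO.mul hDt
      · simpa using (hD0.mul hηO).mul hDt
    have hτO : (fun x : ℝ => Complex.exp (τ * x)) =O[atTop] fun x => Real.exp (τ.re * x) := by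
      refine Asymptotics.IsBigO.of_bound 1 (Eventually.of_forall fun x => ?_)
      rw [Complex.norm_exp]
      simp
    refine ((hτO.smul hO).congr_left fun x => (hEu x).symm).congr_right fun x => ?_
    rw [smul_eq_mul, ← Real.exp_add]
    ring_nf
  rw [← hS, Matrix.transpose_mul]
  calc P 0 * η * (P 0).transpose = P 0 * (η + u) * (P 0).transpose := by rw [hu0, add_zero]
    _ = _ := by simp only [u]; noncomm_ring

end Wedge

/-! ### The spectral projection as a Riesz integral -/

section SpectralProjection
open scoped Matrix.Norms.Operator

/-- If the spectrum of `a` avoids the imaginary axis, then there is a circle, centred on the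
negative real axis and tangent to the imaginary axis at `0`, that encloses the part in the left
half-plane of the spectrum of every `b` near `a`. -/
theorem exists_circle_separating_spectrum {𝔸 : Type*} [NormedRing 𝔸] [NormedAlgebra ℂ 𝔸]
    [CompleteSpace 𝔸] [NormOneClass 𝔸] {a : 𝔸} (ha : ∀ κ ∈ spectrum ℂ a, κ.re ≠ 0) :
    ∃ ρ : ℝ, 0 < ρ ∧ ∀ᶠ b in 𝓝 a, ∀ κ ∈ spectrum ℂ b, κ ∈ Metric.ball (-ρ : ℂ) ρ ∨ 0 < κ.re := by
  set B := ‖a‖ + 1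
  have hB : 0 < B := by positivity
  obtain ⟨δ, hδ, hδ'⟩ : ∃ δ : ℝ, 0 < δ ∧ ∀ κ ∈ spectrum ℂ a, κ.re ≤ 0 → κ.re ≤ -δ := by
    have hcomp : IsCompact (spectrum ℂ a ∩ {κ | κ.re ≤ 0}) :=
      (spectrum.isCompact a).inter_right (isClosed_le Complex.continuous_re continuous_const)
    rcases (spectrum ℂ a ∩ {κ | κ.re ≤ 0}).eq_empty_or_nonempty with h | h
    · exact ⟨1, one_pos, fun κ h1 h2 => (Set.eq_empty_iff_forall_notMem.1 h κ ⟨h1, h2⟩).elim⟩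
    · obtain ⟨κ₀, hκ₀, hmax⟩ := hcomp.exists_isMaxOn h Complex.continuous_re.continuousOn
      refine ⟨-κ₀.re, neg_pos.2 (lt_of_le_of_ne hκ₀.2 (ha κ₀ hκ₀.1)), fun κ h1 h2 => ?_⟩
      rw [neg_neg]
      exact hmax ⟨h1, h2⟩
  -- The disc `|κ + ρ| < ρ` contains every `κ` with `|κ| ≤ B` and `Re κ ≤ -δ`, as `B² < 2 δ ρ`.
  set ρ := B ^ 2 / (2 * δ) + 1
  have hρ : 0 < ρ := by positivity
  have hρδ : B ^ 2 < 2 * δ * ρ := by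
    simp only [ρ]
    rw [mul_add, mul_div_cancel₀ _ (by positivity)]
    linarith
  have hball : ∀ κ : ℂ, κ ∈ Metric.ball (-ρ : ℂ) ρ ↔ κ.re ^ 2 + κ.im ^ 2 + 2 * ρ * κ.re < 0 := by
    intro κ
    rw [Metric.mem_ball, dist_eq_norm, ← sq_lt_sq₀ (norm_nonneg _) hρ.le,
      ← Complex.normSq_eq_norm_sq, Complex.normSq_apply]
    simp
    constructor <;> intro h <;> nlinarith
  refine ⟨ρ, hρ, ?_⟩
  set K : Set ℂ := Metric.closedBall 0 B ∩ {κ | κ.re ≤ 0} ∩ (Metric.ball (-ρ : ℂ) ρ)ᶜ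
  have hK : IsCompact K :=
    ((isCompact_closedBall _ _).inter_right
      (isClosed_le Complex.continuous_re continuous_const)).inter_right
      Metric.isOpen_ball.isClosed_compl
  have hKa : ∀ κ ∈ K, κ ∉ spectrum ℂ a := by
    rintro κ ⟨⟨h1, h2⟩, h3⟩ h4
    refine h3 ((hball κ).2 ?_)
    have h5 := hδ' κ h4 h2
    have h6 : κ.re ^ 2 + κ.im ^ 2 ≤ B ^ 2 := by
      rw [mem_closedBall_zero_iff] at h1
      have := pow_le_pow_left₀ (norm_nonneg _) h1 2
      rw [← Complex.normSq_eq_norm_sq, Complex.normSq_apply] at this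
      linarith
    nlinarith
  have h1 : ∀ᶠ b in 𝓝 a, ∀ κ ∈ K, κ ∉ spectrum ℂ b := by
    refine hK.eventually_forall_of_forall_eventually fun κ hκ => ?_
    have h2 : IsUnit (algebraMap ℂ 𝔸 κ - a) := spectrum.notMem_iff.1 (hKa κ hκ)
    have h3 : ContinuousAt (fun p : 𝔸 × ℂ => algebraMap ℂ 𝔸 p.2 - p.1) (a, κ) := by fun_prop
    filter_upwards [h3.preimage_mem_nhds (Units.isOpen.mem_nhds h2)] with p hp
    exact spectrum.notMem_iff.2 hp
  filter_upwards [h1, Metric.ball_mem_nhds a one_pos] with b hb1 hb2 κ hκ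
  by_contra! h
  refine hb1 κ ⟨⟨?_, h.2⟩, h.1⟩ hκ
  rw [mem_closedBall_zero_iff]
  refine (spectrum.norm_le_norm_of_mem hκ).trans ?_
  have h2 : ‖b‖ ≤ ‖a‖ + ‖b - a‖ := by simpa using norm_add_le a (b - a)
  rw [mem_ball_iff_norm] at hb2
  linarith

theorem eq_zero_of_mem_maxGenEigenspace {n : ℕ} {M : Matrix (Fin n) (Fin n) ℂ} {κ : ℂ}
    (hκ : κ ∉ spectrum ℂ M) {v : Fin n → ℂ}
    (hv : v ∈ Module.End.maxGenEigenspace (Matrix.toLin' M) κ) : v = 0 := by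
  obtain ⟨k, hk⟩ := (Module.End.mem_maxGenEigenspace _ _ _).1 hv
  rw [← Matrix.spectrum_toLin', spectrum.notMem_iff, Algebra.algebraMap_eq_smul_one] at hκ
  have h1 : IsUnit ((Matrix.toLin' M - κ • 1) ^ k) := by
    have := hκ.neg
    rw [neg_sub] at this
    exact this.pow k
  exact ((Module.End.isUnit_iff _).1 h1).injective (by rw [hk, map_zero])

/-- The stable and the unstable subspace are complementary when no eigenvalue is imaginary. -/
theorem isCompl_stableSubspace {n : ℕ} {M : Matrix (Fin n) (Fin n) ℂ}
    (hM : ∀ κ ∈ spectrum ℂ M, κ.re ≠ 0) : IsCompl (stableSubspace M) (unstableSubspace M) := by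
  refine ⟨?_, codisjoint_iff.2 (eq_top_iff.2 ?_)⟩
  · have hd : Disjoint {κ : ℂ | κ.re < 0} {κ : ℂ | 0 < κ.re} :=
      Set.disjoint_left.2 fun κ (h1 : κ.re < 0) (h2 : 0 < κ.re) => lt_asymm h1 h2
    exact (Module.End.independent_maxGenEigenspace (Matrix.toLin' M)).disjoint_biSup_biSup hd
  · rw [← Module.End.iSup_maxGenEigenspace_eq_top (Matrix.toLin' M)]
    refine iSup_le fun κ => ?_
    rcases lt_trichotomy κ.re 0 with h | h | h
    · exact le_sup_of_le_left (le_iSup₂_of_le κ h le_rfl)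
    · intro v hv
      rw [eq_zero_of_mem_maxGenEigenspace (fun h' => hM κ h' h) hv]
      exact zero_mem _
    · exact le_sup_of_le_right (le_iSup₂_of_le κ h le_rfl)

theorem projMatrix_mulVec_of_mem_left {n : ℕ} {S T : Submodule ℂ (Fin n → ℂ)} (h : IsCompl S T)
    {v : Fin n → ℂ} (hv : v ∈ S) : (projMatrix S T).mulVec v = v := by
  rw [projMatrix, dif_pos h, LinearMap.toMatrix'_mulVec,
    Submodule.projection_apply_of_mem_left h hv]

theorem projMatrix_mulVec_of_mem_right {n : ℕ} {S T : Submodule ℂ (Fin n → ℂ)} (h : IsCompl S T)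
    {v : Fin n → ℂ} (hv : v ∈ T) : (projMatrix S T).mulVec v = 0 := by
  rw [projMatrix, dif_pos h, LinearMap.toMatrix'_mulVec]
  exact (Submodule.projection_apply_eq_zero_iff h).2 hv

theorem eq_projMatrix {n : ℕ} {S T : Submodule ℂ (Fin n → ℂ)} (h : IsCompl S T)
    {X : Matrix (Fin n) (Fin n) ℂ} (hS : ∀ v ∈ S, X.mulVec v = v)
    (hT : ∀ v ∈ T, X.mulVec v = 0) : X = projMatrix S T := by
  refine Matrix.toLin'.injective (LinearMap.ext fun v => ?_)
  obtain ⟨s, hs, t, ht, rfl⟩ := Submodule.mem_sup.1 (h.sup_eq_top ▸ Submodule.mem_top : v ∈ S ⊔ T)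
  rw [Matrix.toLin'_apply, Matrix.toLin'_apply, Matrix.mulVec_add, Matrix.mulVec_add, hS s hs,
    hT t ht, projMatrix_mulVec_of_mem_left h hs, projMatrix_mulVec_of_mem_right h ht]

theorem continuousOn_resolvent {M : Matrix (Fin 4) (Fin 4) ℂ} {s : Set ℂ}
    (hs : ∀ ζ ∈ s, ζ ∉ spectrum ℂ M) : ContinuousOn (resolvent M) s := fun ζ hζ =>
  (spectrum.hasDerivAt_resolvent_const_left
    (spectrum.notMem_iff.1 (hs ζ hζ))).continuousAt.continuousWithinAt

theorem resolvent_mulVec_eq {M : Matrix (Fin 4) (Fin 4) ℂ} {ζ κ : ℂ} (hζ : ζ ∉ spectrum ℂ M)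
    (hκ : ζ - κ ≠ 0) (v : Fin 4 → ℂ) :
    (resolvent M ζ).mulVec v =
      (ζ - κ)⁻¹ • v + (ζ - κ)⁻¹ • (resolvent M ζ).mulVec ((M - κ • 1).mulVec v) := by
  have hu : IsUnit (algebraMap ℂ (Matrix (Fin 4) (Fin 4) ℂ) ζ - M) := spectrum.notMem_iff.1 hζ
  have h1 : resolvent M ζ * (algebraMap ℂ (Matrix (Fin 4) (Fin 4) ℂ) ζ - M) = 1 :=
    Ring.inverse_mul_cancel _ hu
  have h2 : resolvent M ζ * (M - κ • 1) = (ζ - κ) • resolvent M ζ - 1 := by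
    have h3 : M - κ • 1 = (ζ - κ) • 1 - (algebraMap ℂ (Matrix (Fin 4) (Fin 4) ℂ) ζ - M) := by
      rw [Algebra.algebraMap_eq_smul_one, sub_smul]
      abel
    rw [h3, mul_sub, h1, Matrix.mul_smul, mul_one]
  rw [Matrix.mulVec_mulVec, h2, Matrix.sub_mulVec, Matrix.one_mulVec, Matrix.smul_mulVec, smul_sub,
    smul_smul, inv_mul_cancel₀ hκ, one_smul]
  abel

open Classical in
theorem circleIntegral_inv_pow (c κ : ℂ) {ρ : ℝ} (hρ : 0 < ρ) (hκ : κ ∉ Metric.sphere c ρ)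
    (j : ℕ) : ∮ ζ in C(c, ρ), ((ζ - κ)⁻¹) ^ (j + 1) =
      if j = 0 ∧ κ ∈ Metric.ball c ρ then 2 * (Real.pi : ℂ) * Complex.I else 0 := by
  rcases j with _ | j
  · simp only [zero_add, pow_one, true_and]
    split_ifs with h
    · exact circleIntegral.integral_sub_inv_of_mem_ball h
    · refine DiffContOnCl.circleIntegral_eq_zero hρ.le (DifferentiableOn.diffContOnCl ?_)
      rw [closure_ball _ hρ.ne']
      intro ζ hζ
      have hne : ζ - κ ≠ 0 := sub_ne_zero.2 fun h' => by
        rw [← h'] at h hκ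
        rw [← Metric.ball_union_sphere] at hζ
        exact hζ.elim h hκ
      exact ((differentiableAt_id.sub_const κ).inv hne).differentiableWithinAt
  · have h1 : ∀ ζ : ℂ, ((ζ - κ)⁻¹) ^ (j + 1 + 1) = (ζ - κ) ^ (-(j + 2 : ℤ)) := fun ζ => by
      rw [zpow_neg, inv_pow]
      norm_cast
    simp_rw [h1]
    rw [circleIntegral.integral_sub_zpow_of_ne (by omega)]
    simp

open Classical in
/-- The integral of the resolvent over a circle acts on a generalized eigenspace as `2 π i` or as
`0`. The powers of `(ζ - κ)⁻¹` are there for the induction on the order of the generalized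
eigenvector. -/
theorem circleIntegral_resolvent_mulVec {M : Matrix (Fin 4) (Fin 4) ℂ} {c κ : ℂ} {ρ : ℝ}
    (hρ : 0 < ρ) (hM : ∀ ζ ∈ Metric.sphere c ρ, ζ ∉ spectrum ℂ M) (hκ : κ ∉ Metric.sphere c ρ)
    (k : ℕ) : ∀ (j : ℕ) (v : Fin 4 → ℂ), ((M - κ • 1) ^ k).mulVec v = 0 →
      ∮ ζ in C(c, ρ), ((ζ - κ)⁻¹) ^ j • (resolvent M ζ).mulVec v =
        (if j = 0 ∧ κ ∈ Metric.ball c ρ then 2 * (Real.pi : ℂ) * Complex.I else 0) • v := by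
  have hne : ∀ ζ ∈ Metric.sphere c ρ, ζ - κ ≠ 0 := fun ζ hζ =>
    sub_ne_zero.2 fun h => hκ (h ▸ hζ)
  have hc1 : ∀ j : ℕ, ContinuousOn (fun ζ : ℂ => ((ζ - κ)⁻¹) ^ j) (Metric.sphere c ρ) := fun j =>
    ((continuousOn_id.sub continuousOn_const).inv₀ hne).pow j
  have hc2 : ∀ v : Fin 4 → ℂ,
      ContinuousOn (fun ζ => (resolvent M ζ).mulVec v) (Metric.sphere c ρ) := fun v => by
    have h1 : Continuous fun X : Matrix (Fin 4) (Fin 4) ℂ => X.mulVec v := by fun_prop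
    exact h1.comp_continuousOn (continuousOn_resolvent hM)
  induction k with
  | zero =>
    intro j v hv
    have : v = 0 := by simpa using hv
    simp [this, circleIntegral]
  | succ k ih =>
    intro j v hv
    have hu : ((M - κ • 1) ^ k).mulVec ((M - κ • 1).mulVec v) = 0 := by
      rw [Matrix.mulVec_mulVec, ← pow_succ, hv]
    have h1 : EqOn (fun ζ => ((ζ - κ)⁻¹) ^ j • (resolvent M ζ).mulVec v)
        (fun ζ => ((ζ - κ)⁻¹) ^ (j + 1) • v +
          ((ζ - κ)⁻¹) ^ (j + 1) • (resolvent M ζ).mulVec ((M - κ • 1).mulVec v))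
        (Metric.sphere c ρ) := fun ζ hζ => by
      simp only
      rw [resolvent_mulVec_eq (hM ζ hζ) (hne ζ hζ) v, smul_add, smul_smul, smul_smul, ← pow_succ]
    rw [circleIntegral.integral_congr hρ.le h1, circleIntegral.integral_add,
      circleIntegral.integral_smul_const, ih (j + 1) _ hu, circleIntegral_inv_pow c κ hρ hκ]
    · simp
    · exact ContinuousOn.circleIntegrable hρ.le ((hc1 _).smul continuousOn_const)
    · exact ContinuousOn.circleIntegrable hρ.le ((hc1 _).smul (hc2 _))

/-- The Riesz projection `(2 π i)⁻¹ ∮ (ζ - M)⁻¹ dζ` for the circle `|ζ + ρ| = ρ`. -/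
noncomputable def rieszProj (ρ : ℝ) (M : Matrix (Fin 4) (Fin 4) ℂ) : Matrix (Fin 4) (Fin 4) ℂ :=
  (2 * (Real.pi : ℂ) * Complex.I)⁻¹ • ∮ ζ in C(-ρ, ρ), resolvent M ζ

theorem re_nonpos_of_mem_closedBall {ρ : ℝ} {κ : ℂ}
    (h : κ ∈ Metric.closedBall (-ρ : ℂ) ρ) : κ.re ≤ 0 := by
  rw [mem_closedBall_iff_norm] at h
  have h1 := (Complex.abs_re_le_norm _).trans h
  have h2 := (le_abs_self _).trans h1
  simp at h2
  exact h2

theorem circle_disjoint_spectrum {M : Matrix (Fin 4) (Fin 4) ℂ} {ρ : ℝ}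
    (h : ∀ κ ∈ spectrum ℂ M, κ ∈ Metric.ball (-ρ : ℂ) ρ ∨ 0 < κ.re) :
    ∀ ζ ∈ Metric.sphere (-ρ : ℂ) ρ, ζ ∉ spectrum ℂ M := fun ζ hζ hmem => by
  rcases h ζ hmem with h1 | h1
  · exact (Metric.mem_ball.1 h1).ne (Metric.mem_sphere.1 hζ)
  · exact (re_nonpos_of_mem_closedBall (Metric.sphere_subset_closedBall hζ)).not_gt h1

theorem rieszProj_mulVec {M : Matrix (Fin 4) (Fin 4) ℂ} {ρ : ℝ} (hρ : 0 < ρ)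
    (h : ∀ κ ∈ spectrum ℂ M, κ ∈ Metric.ball (-ρ : ℂ) ρ ∨ 0 < κ.re) {κ : ℂ}
    (hκ : κ ∈ spectrum ℂ M) {v : Fin 4 → ℂ}
    (hv : v ∈ Module.End.maxGenEigenspace (Matrix.toLin' M) κ) :
    (rieszProj ρ M).mulVec v = if κ.re < 0 then v else 0 := by
  have hs := circle_disjoint_spectrum h
  have hκs : κ ∉ Metric.sphere (-ρ : ℂ) ρ := fun h' => hs κ h' hκ
  obtain ⟨k, hk⟩ := (Module.End.mem_maxGenEigenspace _ _ _).1 hv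
  have hk' : ((M - κ • 1) ^ k).mulVec v = 0 := by
    have h1 : (Matrix.toLin' M - κ • 1) ^ k = Matrix.toLin' ((M - κ • 1) ^ k) := by
      rw [Matrix.toLin'_pow, map_sub, map_smul, Matrix.toLin'_one]
      rfl
    rwa [h1, Matrix.toLin'_apply] at hk
  have h1 := circleIntegral_resolvent_mulVec hρ hs hκs k 0 v hk'
  simp only [pow_zero, one_smul, true_and] at h1
  have hint : CircleIntegrable (resolvent M) (-ρ) ρ :=
    ContinuousOn.circleIntegrable hρ.le (continuousOn_resolvent hs)
  let L : Matrix (Fin 4) (Fin 4) ℂ →L[ℂ] (Fin 4 → ℂ) :=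
    LinearMap.toContinuousLinearMap
      { toFun := fun X => X.mulVec v
        map_add' := fun X Y => Matrix.add_mulVec X Y v
        map_smul' := fun c X => Matrix.smul_mulVec c X v }
  have h2 : (∮ ζ in C(-ρ, ρ), resolvent M ζ).mulVec v =
      ∮ ζ in C(-ρ, ρ), (resolvent M ζ).mulVec v := by
    have h3 := L.intervalIntegral_comp_comm hint.out
    have h4 : ∀ θ : ℝ, L (deriv (circleMap (-ρ : ℂ) ρ) θ • resolvent M (circleMap (-ρ) ρ θ)) =
      deriv (circleMap (-ρ : ℂ) ρ) θ • (resolvent M (circleMap (-ρ) ρ θ)).mulVec v :=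
      fun θ => by rw [map_smul]; rfl
    rw [circleIntegral, circleIntegral]
    simp_rw [← h4]
    exact h3.symm
  have hball : κ ∈ Metric.ball (-ρ : ℂ) ρ ↔ κ.re < 0 := by
    constructor
    · intro h'
      refine lt_of_le_of_ne (re_nonpos_of_mem_closedBall (Metric.ball_subset_closedBall h'))
        fun h0 => ?_
      rw [mem_ball_iff_norm] at h'
      have h3 := (Complex.abs_re_le_norm _).trans_lt h'
      simp [h0, abs_of_pos hρ] at h3
    · intro h'
      exact (h κ hκ).resolve_right (not_lt.2 h'.le)
  rw [rieszProj, Matrix.smul_mulVec, h2, h1]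
  split_ifs with h3 h4 h4
  · rw [smul_smul, inv_mul_cancel₀ Complex.two_pi_I_ne_zero, one_smul]
  · exact absurd (hball.1 h3.2) h4
  · exact absurd ⟨rfl, hball.2 h4⟩ h3
  · simp

end SpectralProjection

/-! ### Holomorphy of the stable projection -/

section StableProj
open scoped Matrix.Norms.Operator

theorem stableProj_eq_rieszProj {M : Matrix (Fin 4) (Fin 4) ℂ} {ρ : ℝ} (hρ : 0 < ρ)
    (h : ∀ κ ∈ spectrum ℂ M, κ ∈ Metric.ball (-ρ : ℂ) ρ ∨ 0 < κ.re) :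
    stableProj M = rieszProj ρ M := by
  have hM : ∀ κ ∈ spectrum ℂ M, κ.re ≠ 0 := fun κ hκ h0 => by
    rcases h κ hκ with h1 | h1
    · rw [mem_ball_iff_norm] at h1
      have h3 := (Complex.abs_re_le_norm _).trans_lt h1
      simp [h0, abs_of_pos hρ] at h3
    · exact h1.ne' h0
  have key : ∀ κ, ∀ v ∈ Module.End.maxGenEigenspace (Matrix.toLin' M) κ,
      (rieszProj ρ M).mulVec v = if κ.re < 0 then v else 0 := fun κ v hv => by
    by_cases hκ : κ ∈ spectrum ℂ M
    · exact rieszProj_mulVec hρ h hκ hv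
    · simp [eq_zero_of_mem_maxGenEigenspace hκ hv]
  refine (eq_projMatrix (isCompl_stableSubspace hM) (fun v hv => ?_) (fun v hv => ?_)).symm
  · have h1 : stableSubspace M ≤ LinearMap.eqLocus (Matrix.toLin' (rieszProj ρ M)) LinearMap.id :=
      iSup₂_le fun κ hκ v hv => by
        rw [LinearMap.mem_eqLocus, Matrix.toLin'_apply, key κ v hv, if_pos hκ, LinearMap.id_apply]
    exact h1 hv
  · have h1 : unstableSubspace M ≤ LinearMap.ker (Matrix.toLin' (rieszProj ρ M)) :=
      iSup₂_le fun κ hκ v hv => by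
        rw [LinearMap.mem_ker, Matrix.toLin'_apply, key κ v hv, if_neg (not_lt.2 hκ.le)]
    exact h1 hv

theorem hasDerivAt_resolvent_affine {X Y : Matrix (Fin 4) (Fin 4) ℂ} {z ζ : ℂ}
    (h : ζ ∉ spectrum ℂ (X + z • Y)) :
    HasDerivAt (fun z : ℂ => resolvent (X + z • Y) ζ)
      (resolvent (X + z • Y) ζ * Y * resolvent (X + z • Y) ζ) z := by
  obtain ⟨u, hu⟩ := spectrum.notMem_iff.1 h
  have h1 : HasDerivAt (fun z : ℂ => algebraMap ℂ (Matrix (Fin 4) (Fin 4) ℂ) ζ - (X + z • Y))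
      (-Y) z := by
    refine ((((hasDerivAt_id z).smul_const Y).const_add X).const_sub
      (algebraMap ℂ (Matrix (Fin 4) (Fin 4) ℂ) ζ)).congr_deriv ?_
    simp
  have h2 := hasFDerivAt_ringInverse (𝕜 := ℂ) u
  rw [hu] at h2
  have h3 := h2.comp_hasDerivAt z h1
  have h4 : resolvent (X + z • Y) ζ = ↑u⁻¹ := by rw [resolvent, ← hu, Ring.inverse_unit]
  rw [h4]
  refine h3.congr_deriv ?_
  simp

theorem continuousAt_resolvent_affine {X Y : Matrix (Fin 4) (Fin 4) ℂ} {p : ℂ × ℂ}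
    (h : p.2 ∉ spectrum ℂ (X + p.1 • Y)) :
    ContinuousAt (fun p : ℂ × ℂ => resolvent (X + p.1 • Y) p.2) p := by
  obtain ⟨u, hu⟩ := spectrum.notMem_iff.1 h
  have h1 : ContinuousAt Ring.inverse
      (algebraMap ℂ (Matrix (Fin 4) (Fin 4) ℂ) p.2 - (X + p.1 • Y)) := by
    rw [← hu]; exact NormedRing.inverse_continuousAt u
  have h2 : Continuous fun p : ℂ × ℂ =>
      algebraMap ℂ (Matrix (Fin 4) (Fin 4) ℂ) p.2 - (X + p.1 • Y) := by fun_prop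
  exact ContinuousAt.comp (f := fun p : ℂ × ℂ =>
      algebraMap ℂ (Matrix (Fin 4) (Fin 4) ℂ) p.2 - (X + p.1 • Y)) h1 h2.continuousAt

theorem differentiableAt_rieszProj_affine {X Y : Matrix (Fin 4) (Fin 4) ℂ} {z₀ : ℂ} {ρ : ℝ}
    (h : ∀ᶠ z in 𝓝 z₀, ∀ ζ ∈ Metric.sphere (-ρ : ℂ) ρ, ζ ∉ spectrum ℂ (X + z • Y))
    (hρ : 0 < ρ) : DifferentiableAt ℂ (fun z : ℂ => rieszProj ρ (X + z • Y)) z₀ := by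
  obtain ⟨ε, hε, hball⟩ := Metric.nhds_basis_closedBall.eventually_iff.1 h
  have hmem : ∀ θ : ℝ, circleMap (-ρ : ℂ) ρ θ ∈ Metric.sphere (-ρ : ℂ) ρ :=
    fun θ => circleMap_mem_sphere _ hρ.le θ
  have hderiv : Continuous (deriv (circleMap (-ρ : ℂ) ρ)) := by
    have : deriv (circleMap (-ρ : ℂ) ρ) = fun θ => circleMap 0 ρ θ * Complex.I :=
      funext fun θ => deriv_circleMap _ _ _
    rw [this]
    exact (continuous_circleMap 0 ρ).mul continuous_const
  have hres : ContinuousOn (fun p : ℂ × ℝ => resolvent (X + p.1 • Y) (circleMap (-ρ : ℂ) ρ p.2))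
      (Metric.closedBall z₀ ε ×ˢ univ) := fun p hp => by
    have h1 : ContinuousAt (fun p : ℂ × ℂ => resolvent (X + p.1 • Y) p.2)
        (p.1, circleMap (-ρ : ℂ) ρ p.2) := continuousAt_resolvent_affine (hball hp.1 _ (hmem _))
    have h2 : Continuous fun p : ℂ × ℝ => (p.1, circleMap (-ρ : ℂ) ρ p.2) :=
      continuous_fst.prodMk ((continuous_circleMap _ _).comp continuous_snd)
    exact (ContinuousAt.comp (f := fun p : ℂ × ℝ => (p.1, circleMap (-ρ : ℂ) ρ p.2)) h1
      h2.continuousAt).continuousWithinAt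
  set G' : ℂ → ℝ → Matrix (Fin 4) (Fin 4) ℂ := fun z θ => deriv (circleMap (-ρ : ℂ) ρ) θ •
    (resolvent (X + z • Y) (circleMap (-ρ : ℂ) ρ θ) * Y *
      resolvent (X + z • Y) (circleMap (-ρ : ℂ) ρ θ))
  have hG' : ContinuousOn (fun p : ℂ × ℝ => G' p.1 p.2) (Metric.closedBall z₀ ε ×ˢ univ) :=
    (hderiv.comp continuous_snd).continuousOn.smul ((hres.mul continuousOn_const).mul hres)
  have hslice : ∀ z ∈ Metric.closedBall z₀ ε, Continuous fun θ : ℝ =>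
      resolvent (X + z • Y) (circleMap (-ρ : ℂ) ρ θ) := fun z hz => by
    have := hres.comp (f := fun θ : ℝ => (z, θ)) (s := univ) (by fun_prop)
      (fun θ _ => ⟨hz, mem_univ _⟩)
    exact continuousOn_univ.1 this
  obtain ⟨b, hb⟩ := ((isCompact_closedBall z₀ ε).prod
    (isCompact_uIcc (a := (0 : ℝ)) (b := 2 * Real.pi))).bddAbove_image
      (hG'.norm.mono (prod_mono_right (subset_univ _)))
  have hz₀ : z₀ ∈ Metric.closedBall z₀ ε := Metric.mem_closedBall_self hε.le
  have : TopologicalSpace.PseudoMetrizableSpace (Matrix (Fin 4) (Fin 4) ℂ) :=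
    inferInstanceAs (TopologicalSpace.PseudoMetrizableSpace (Fin 4 → Fin 4 → ℂ))
  have main := intervalIntegral.hasDerivAt_integral_of_dominated_loc_of_deriv_le
    (μ := MeasureTheory.volume) (a := 0) (b := 2 * Real.pi) (bound := fun _ => b)
    (F := fun z θ => deriv (circleMap (-ρ : ℂ) ρ) θ •
      resolvent (X + z • Y) (circleMap (-ρ : ℂ) ρ θ)) (F' := G') (x₀ := z₀)
    (s := Metric.closedBall z₀ ε) (Metric.closedBall_mem_nhds z₀ hε)
    (by
      filter_upwards [Metric.closedBall_mem_nhds z₀ hε] with z hz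
      exact (hderiv.smul (hslice z hz)).aestronglyMeasurable)
    ((hderiv.smul (hslice z₀ hz₀)).intervalIntegrable _ _)
    ((hderiv.smul (((hslice z₀ hz₀).mul continuous_const).mul
      (hslice z₀ hz₀))).aestronglyMeasurable)
    (Eventually.of_forall fun θ hθ z hz => hb ⟨(z, θ), ⟨hz, uIoc_subset_uIcc hθ⟩, rfl⟩)
    intervalIntegrable_const
    (Eventually.of_forall fun θ _ z hz =>
      (hasDerivAt_resolvent_affine (hball hz _ (hmem θ))).const_smul
        (deriv (circleMap (-ρ : ℂ) ρ) θ))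
  exact main.2.differentiableAt.const_smul (2 * (Real.pi : ℂ) * Complex.I)⁻¹

/-- The spectral projection depends holomorphically on the parameter of an affine family, as long
as no eigenvalue is imaginary. -/
theorem differentiableAt_stableProj_affine {X Y : Matrix (Fin 4) (Fin 4) ℂ} {z₀ : ℂ}
    (h : ∀ κ ∈ spectrum ℂ (X + z₀ • Y), κ.re ≠ 0) :
    DifferentiableAt ℂ (fun z : ℂ => stableProj (X + z • Y)) z₀ := by
  obtain ⟨ρ, hρ, hev⟩ := exists_circle_separating_spectrum h
  have hc : Continuous fun z : ℂ => X + z • Y := by fun_prop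
  have hev' := hc.continuousAt.eventually hev
  refine (differentiableAt_rieszProj_affine (hev'.mono fun z hz =>
    circle_disjoint_spectrum hz) hρ).congr_of_eventuallyEq ?_
  filter_upwards [hev'] with z hz
  exact stableProj_eq_rieszProj hρ hz

theorem isOpen_spectrum_disjoint_imaginary (X Y : Matrix (Fin 4) (Fin 4) ℂ) :
    IsOpen {z : ℂ | ∀ κ ∈ spectrum ℂ (X + z • Y), κ.re ≠ 0} := by
  rw [isOpen_iff_mem_nhds]
  intro z₀ hz₀
  obtain ⟨ρ, hρ, hev⟩ := exists_circle_separating_spectrum hz₀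
  have hc : Continuous fun z : ℂ => X + z • Y := by fun_prop
  filter_upwards [hc.continuousAt.eventually hev] with z hz κ hκ h0
  rcases hz κ hκ with h1 | h1
  · rw [mem_ball_iff_norm] at h1
    have h3 := (Complex.abs_re_le_norm _).trans_lt h1
    simp [h0, abs_of_pos hρ] at h3
  · exact h1.ne' h0

theorem mulVec_mem_stableSubspace {n : ℕ} {M : Matrix (Fin n) (Fin n) ℂ} {v : Fin n → ℂ}
    (hv : v ∈ stableSubspace M) : M.mulVec v ∈ stableSubspace M := by
  have h1 : stableSubspace M ≤ (stableSubspace M).comap (Matrix.toLin' M) :=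
    iSup₂_le fun κ hκ v hv => by
      refine Submodule.mem_iSup_of_mem κ (Submodule.mem_iSup_of_mem hκ ?_)
      exact Module.End.mapsTo_maxGenEigenspace_of_comm (Commute.refl _) κ hv
  exact h1 hv

theorem mulVec_mem_unstableSubspace {n : ℕ} {M : Matrix (Fin n) (Fin n) ℂ} {v : Fin n → ℂ}
    (hv : v ∈ unstableSubspace M) : M.mulVec v ∈ unstableSubspace M := by
  have h1 : unstableSubspace M ≤ (unstableSubspace M).comap (Matrix.toLin' M) :=
    iSup₂_le fun κ hκ v hv => by
      refine Submodule.mem_iSup_of_mem κ (Submodule.mem_iSup_of_mem hκ ?_)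
      exact Module.End.mapsTo_maxGenEigenspace_of_comm (Commute.refl _) κ hv
  exact h1 hv

theorem maxGenEigenspace_neg {V : Type*} [AddCommGroup V] [Module ℂ V] (f : Module.End ℂ V)
    (κ : ℂ) : Module.End.maxGenEigenspace (-f) κ = Module.End.maxGenEigenspace f (-κ) := by
  ext v
  rw [Module.End.mem_maxGenEigenspace, Module.End.mem_maxGenEigenspace]
  refine exists_congr fun k => ?_
  have h1 : -f - κ • 1 = -(f - (-κ) • 1) := by
    rw [neg_smul]; abel
  rw [h1]
  rcases neg_one_pow_eq_or (Module.End ℂ V) k with h2 | h2 <;>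
    rw [neg_pow, h2] <;> simp

theorem stableSubspace_neg {n : ℕ} (M : Matrix (Fin n) (Fin n) ℂ) :
    stableSubspace (-M) = unstableSubspace M := by
  rw [stableSubspace, unstableSubspace]
  simp_rw [map_neg, maxGenEigenspace_neg]
  refine (Equiv.neg ℂ).iSup_congr fun κ => ?_
  simp

theorem unstableSubspace_neg {n : ℕ} (M : Matrix (Fin n) (Fin n) ℂ) :
    unstableSubspace (-M) = stableSubspace M := by
  rw [← stableSubspace_neg, neg_neg]

theorem unstableProj_eq_stableProj_neg {n : ℕ} (M : Matrix (Fin n) (Fin n) ℂ) :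
    unstableProj M = stableProj (-M) := by
  rw [unstableProj, stableProj, stableSubspace_neg, unstableSubspace_neg]

theorem range_stableProj {n : ℕ} {M : Matrix (Fin n) (Fin n) ℂ}
    (h : IsCompl (stableSubspace M) (unstableSubspace M)) :
    LinearMap.range (Matrix.toLin' (stableProj M)) = stableSubspace M := by
  rw [stableProj, projMatrix, dif_pos h, Matrix.toLin'_toMatrix', Submodule.range_projection]

theorem stableProj_mul_self {n : ℕ} {M : Matrix (Fin n) (Fin n) ℂ}
    (h : IsCompl (stableSubspace M) (unstableSubspace M)) :
    stableProj M * stableProj M = stableProj M := by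
  rw [stableProj, projMatrix, dif_pos h, ← LinearMap.toMatrix'_mul,
    (Submodule.isIdempotentElem_projection h).eq]

theorem stableProj_commute {n : ℕ} {M : Matrix (Fin n) (Fin n) ℂ}
    (h : IsCompl (stableSubspace M) (unstableSubspace M)) :
    M * stableProj M = stableProj M * M := by
  refine Matrix.toLin'.injective (LinearMap.ext fun v => ?_)
  obtain ⟨s, hs, t, ht, rfl⟩ := Submodule.mem_sup.1
    (h.sup_eq_top ▸ Submodule.mem_top : v ∈ stableSubspace M ⊔ unstableSubspace M)
  simp only [Matrix.toLin'_apply, Matrix.mulVec_add, ← Matrix.mulVec_mulVec, stableProj]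
  rw [projMatrix_mulVec_of_mem_left h hs, projMatrix_mulVec_of_mem_right h ht,
    projMatrix_mulVec_of_mem_left h (mulVec_mem_stableSubspace hs),
    projMatrix_mulVec_of_mem_right h (mulVec_mem_unstableSubspace ht), Matrix.mulVec_zero]

end StableProj

/-! ### Kato's equation -/

section Kato
open scoped Matrix.Norms.Operator

/-- A solution of a homogeneous linear equation on `(0, 1]` that is continuous on `[0, 1]` vanishes
at one end point if and only if it does at the other. -/
theorem eq_zero_iff_of_norm_deriv_le {E : Type*} [NormedAddCommGroup E] [NormedSpace ℝ E]
    {f f' : ℝ → E} {K : ℝ} (hc : ContinuousOn f (Icc 0 1))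
    (hd : ∀ t ∈ Ioc (0 : ℝ) 1, HasDerivAt f (f' t) t)
    (hb : ∀ t ∈ Ioc (0 : ℝ) 1, ‖f' t‖ ≤ K * ‖f t‖) : f 0 = 0 ↔ f 1 = 0 := by
  constructor
  · intro h0
    have h1 : ∀ s ∈ Ioc (0 : ℝ) 1, ‖f 1‖ ≤ ‖f s‖ * Real.exp (K * (1 - s)) := fun s hs => by
      have := norm_le_gronwallBound_of_norm_deriv_right_le (f := f) (f' := f') (δ := ‖f s‖) (K := K)
        (ε := 0) (a := s) (b := 1) (hc.mono (Icc_subset_Icc_left hs.1.le))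
        (fun t ht => (hd t ⟨hs.1.trans_le ht.1, ht.2.le⟩).hasDerivWithinAt) le_rfl
        (fun t ht => by simpa using hb t ⟨hs.1.trans_le ht.1, ht.2.le⟩) 1 ⟨hs.2, le_rfl⟩
      rwa [gronwallBound_ε0] at this
    have h2 : Tendsto f (𝓝[>] 0) (𝓝 0) := by
      have := (hc 0 ⟨le_rfl, zero_le_one⟩).mono_left
        (nhdsWithin_mono 0 (Ioc_subset_Icc_self (a := (0 : ℝ)) (b := 1)))
      rwa [h0, nhdsWithin_Ioc_eq_nhdsGT zero_lt_one] at this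
    have h3 : Tendsto (fun s : ℝ => ‖f s‖ * Real.exp (K * (1 - s))) (𝓝[>] 0)
        (𝓝 (‖(0 : E)‖ * Real.exp (K * (1 - 0)))) := by
      refine h2.norm.mul (Tendsto.mono_left ?_ nhdsWithin_le_nhds)
      exact Continuous.tendsto (by fun_prop) 0
    have h4 : ‖f 1‖ ≤ ‖(0 : E)‖ * Real.exp (K * (1 - 0)) := by
      refine ge_of_tendsto h3 ?_
      filter_upwards [Ioc_mem_nhdsGT (zero_lt_one' ℝ)] with s hs using h1 s hs
    simpa using h4
  · intro h1
    have hd' : ∀ t ∈ Ico (0 : ℝ) 1, HasDerivAt (fun t => f (1 - t)) (-f' (1 - t)) t :=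
      fun t ht => by
        have h2 := (hd (1 - t) ⟨by linarith [ht.2], by linarith [ht.1]⟩).scomp t
          ((hasDerivAt_id t).const_sub 1)
        simpa [Function.comp_def] using h2
    have := norm_le_gronwallBound_of_norm_deriv_right_le (f := fun t => f (1 - t))
      (f' := fun t => -f' (1 - t)) (δ := 0) (K := K) (ε := 0) (a := 0) (b := 1)
      (hc.comp (by fun_prop) fun t ht => ⟨by linarith [ht.2], by linarith [ht.1]⟩)
      (fun t ht => (hd' t ht).hasDerivWithinAt) (by simp [h1])
      (fun t ht => by
        simpa using hb (1 - t) ⟨by linarith [ht.2], by linarith [ht.1]⟩) 1 ⟨zero_le_one, le_rfl⟩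
    rw [gronwallBound_ε0] at this
    simpa using this

/-- The segment from `z` to `z₀`. -/
def segmentPath (z z₀ : ℂ) (t : ℝ) : ℂ := z + t * (z₀ - z)

theorem continuous_segmentPath (z z₀ : ℂ) : Continuous (segmentPath z z₀) := by
  unfold segmentPath; fun_prop

theorem hasDerivAt_segmentPath (z z₀ : ℂ) (t : ℝ) :
    HasDerivAt (segmentPath z z₀) (z₀ - z) t := by
  exact (((Complex.ofRealCLM.hasDerivAt (x := t)).mul_const (z₀ - z)).const_add z).congr_deriv
    (by simp)

theorem re_segmentPath_pos {z z₀ : ℂ} (hz : 0 ≤ z.re) (hz₀ : 0 < z₀.re) {t : ℝ}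
    (ht : t ∈ Ioc (0 : ℝ) 1) : 0 < (segmentPath z z₀ t).re := by
  have : (segmentPath z z₀ t).re = (1 - t) * z.re + t * z₀.re := by
    simp [segmentPath]; ring
  rw [this]
  have h1 := mul_nonneg (sub_nonneg.2 ht.2) hz
  have h2 := mul_pos ht.1 hz₀
  linarith

@[simp] theorem segmentPath_zero (z z₀ : ℂ) : segmentPath z z₀ 0 = z := by simp [segmentPath]

@[simp] theorem segmentPath_one (z z₀ : ℂ) : segmentPath z z₀ 1 = z₀ := by simp [segmentPath]

/-- The closed right half-plane without the origin. -/
def puncturedHalfPlane : Set ℂ := {z | 0 ≤ z.re ∧ z ≠ 0}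

theorem segmentPath_mem {z z₀ : ℂ} (hz : z ∈ puncturedHalfPlane) (hz₀ : 0 < z₀.re) {t : ℝ}
    (ht : t ∈ Icc (0 : ℝ) 1) : segmentPath z z₀ t ∈ puncturedHalfPlane := by
  rcases ht.1.eq_or_lt with h | h
  · rwa [← h, segmentPath_zero]
  · have := re_segmentPath_pos hz.1 hz₀ ⟨h, ht.2⟩
    exact ⟨this.le, fun h0 => by simp [h0] at this⟩

variable {Pr : ℂ → Matrix (Fin 4) (Fin 4) ℂ} {U : Set ℂ}

/-- The derivative of a family of projections has no diagonal blocks: this is what makes the flow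
of Kato's equation intertwine the projections. -/
theorem mul_deriv_mul_eq_zero (hU : IsOpen U) (hPr : DifferentiableOn ℂ Pr U)
    (hid : ∀ z ∈ U, Pr z * Pr z = Pr z) {z : ℂ} (hz : z ∈ U) :
    Pr z * deriv Pr z + deriv Pr z * Pr z = deriv Pr z ∧ Pr z * deriv Pr z * Pr z = 0 := by
  have h1 : HasDerivAt Pr (deriv Pr z) z :=
    ((hPr z hz).differentiableAt (hU.mem_nhds hz)).hasDerivAt
  have h2 : HasDerivAt Pr (deriv Pr z * Pr z + Pr z * deriv Pr z) z :=
    (h1.mul h1).congr_of_eventuallyEq (by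
      filter_upwards [hU.mem_nhds hz] with w hw
      exact (hid w hw).symm)
  have h3 : Pr z * deriv Pr z + deriv Pr z * Pr z = deriv Pr z := by
    rw [add_comm]; exact h2.unique h1
  refine ⟨h3, ?_⟩
  have h4 : Pr z * (Pr z * deriv Pr z + deriv Pr z * Pr z) * Pr z = Pr z * deriv Pr z * Pr z := by
    rw [h3]
  have h5 : Pr z * (Pr z * deriv Pr z + deriv Pr z * Pr z) * Pr z =
      (Pr z * Pr z) * deriv Pr z * Pr z + Pr z * deriv Pr z * (Pr z * Pr z) := by noncomm_ring
  rw [h5, hid z hz] at h4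
  simpa using h4

theorem exists_bound_on_segment (hU : IsOpen U) (hUH : puncturedHalfPlane ⊆ U)
    (hPr : DifferentiableOn ℂ Pr U) {z z₀ : ℂ} (hz : z ∈ puncturedHalfPlane) (hz₀ : 0 < z₀.re) :
    ∃ K : ℝ, ∀ t ∈ Icc (0 : ℝ) 1, ‖Pr (segmentPath z z₀ t)‖ ≤ K ∧
      ‖deriv Pr (segmentPath z z₀ t)‖ ≤ K := by
  have hmaps : MapsTo (segmentPath z z₀) (Icc 0 1) U := fun t ht => hUH (segmentPath_mem hz hz₀ ht)
  have h1 : ContinuousOn (fun t => Pr (segmentPath z z₀ t)) (Icc 0 1) :=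
    hPr.continuousOn.comp (continuous_segmentPath z z₀).continuousOn hmaps
  have h2 : ContinuousOn (fun t => deriv Pr (segmentPath z z₀ t)) (Icc 0 1) :=
    (hPr.deriv hU).continuousOn.comp (continuous_segmentPath z z₀).continuousOn hmaps
  obtain ⟨K₁, hK₁⟩ := isCompact_Icc.bddAbove_image h1.norm
  obtain ⟨K₂, hK₂⟩ := isCompact_Icc.bddAbove_image h2.norm
  exact ⟨max K₁ K₂, fun t ht => ⟨(hK₁ ⟨t, ht, rfl⟩).trans (le_max_left _ _),
    (hK₂ ⟨t, ht, rfl⟩).trans (le_max_right _ _)⟩⟩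

/-- A solution of Kato's equation that vanishes at a point of the punctured closed half-plane
vanishes identically. -/
theorem kato_eq_zero (hU : IsOpen U) (hUH : puncturedHalfPlane ⊆ U)
    (hPr : DifferentiableOn ℂ Pr U) {X : ℂ → Matrix (Fin 4) (Fin 4) ℂ}
    (hX : ∀ z : ℂ, 0 < z.re → HasDerivAt X (deriv Pr z * X z) z)
    (hXc : ContinuousOn X puncturedHalfPlane) {z z₀ : ℂ} (hz : z ∈ puncturedHalfPlane)
    (hz₀ : 0 < z₀.re) (h : X z = 0) : X z₀ = 0 := by
  obtain ⟨K, hK⟩ := exists_bound_on_segment hU hUH hPr hz hz₀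
  have := eq_zero_iff_of_norm_deriv_le (f := fun t => X (segmentPath z z₀ t))
    (f' := fun t => (z₀ - z) • (deriv Pr (segmentPath z z₀ t) * X (segmentPath z z₀ t)))
    (K := ‖z₀ - z‖ * K)
    (hXc.comp (continuous_segmentPath z z₀).continuousOn fun t ht => segmentPath_mem hz hz₀ ht)
    (fun t ht => (hX _ (re_segmentPath_pos hz.1 hz₀ ht)).scomp t (hasDerivAt_segmentPath z z₀ t))
    (fun t ht => by
      rw [norm_smul, mul_assoc]
      gcongr
      refine (norm_mul_le _ _).trans ?_
      gcongr
      exact (hK t ⟨ht.1.le, ht.2⟩).2)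
  simp only [segmentPath_zero, segmentPath_one] at this
  exact this.1 h

/-- The flow of Kato's equation preserves the range of the projections. -/
theorem kato_mem_range (hU : IsOpen U) (hUH : puncturedHalfPlane ⊆ U)
    (hPr : DifferentiableOn ℂ Pr U) (hid : ∀ z ∈ U, Pr z * Pr z = Pr z)
    {X : ℂ → Matrix (Fin 4) (Fin 4) ℂ}
    (hX : ∀ z : ℂ, 0 < z.re → HasDerivAt X (deriv Pr z * X z) z)
    (hXc : ContinuousOn X puncturedHalfPlane) {z z₀ : ℂ} (hz : z ∈ puncturedHalfPlane)
    (hz₀ : 0 < z₀.re) (h : Pr z₀ * X z₀ = X z₀) : Pr z * X z = X z := by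
  obtain ⟨K, hK⟩ := exists_bound_on_segment hU hUH hPr hz hz₀
  have hK0 : 0 ≤ K := (norm_nonneg _).trans (hK 0 ⟨le_rfl, zero_le_one⟩).1
  set G : ℂ → Matrix (Fin 4) (Fin 4) ℂ := fun z => X z - Pr z * X z
  have hG : ∀ w : ℂ, 0 < w.re → HasDerivAt G (-(Pr w * deriv Pr w * G w)) w := fun w hw => by
    have hwU : w ∈ U := hUH ⟨hw.le, fun h0 => by simp [h0] at hw⟩
    have h1 : HasDerivAt Pr (deriv Pr w) w :=
      ((hPr w hwU).differentiableAt (hU.mem_nhds hwU)).hasDerivAt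
    refine ((hX w hw).sub (h1.mul (hX w hw))).congr_deriv ?_
    have h2 := (mul_deriv_mul_eq_zero hU hPr hid hwU).2
    have h3 : Pr w * deriv Pr w * G w =
        Pr w * deriv Pr w * X w - (Pr w * deriv Pr w * Pr w) * X w := by
      simp only [G]; noncomm_ring
    rw [h3, h2]
    noncomm_ring
  have hGc : ContinuousOn G puncturedHalfPlane :=
    hXc.sub ((hPr.continuousOn.mono hUH).mul hXc)
  have := eq_zero_iff_of_norm_deriv_le (f := fun t => G (segmentPath z z₀ t))
    (f' := fun t => (z₀ - z) • -(Pr (segmentPath z z₀ t) * deriv Pr (segmentPath z z₀ t) *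
      G (segmentPath z z₀ t)))
    (K := ‖z₀ - z‖ * (K * K))
    (hGc.comp (continuous_segmentPath z z₀).continuousOn fun t ht => segmentPath_mem hz hz₀ ht)
    (fun t ht => (hG _ (re_segmentPath_pos hz.1 hz₀ ht)).scomp t (hasDerivAt_segmentPath z z₀ t))
    (fun t ht => by
      rw [norm_smul, norm_neg, mul_assoc ‖z₀ - z‖]
      refine mul_le_mul_of_nonneg_left ?_ (norm_nonneg (z₀ - z))
      obtain ⟨h1, h2⟩ := hK t ⟨ht.1.le, ht.2⟩
      refine (norm_mul_le _ _).trans (mul_le_mul_of_nonneg_right ?_ (norm_nonneg (G _)))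
      exact (norm_mul_le _ _).trans (mul_le_mul h1 h2 (norm_nonneg (deriv Pr _)) hK0))
  simp only [segmentPath_zero, segmentPath_one] at this
  exact (sub_eq_zero.1 (this.2 (by simp only [G]; rw [h, sub_self]))).symm

/-- The trace of a holomorphic family of projections, that is its rank, is constant: the derivative
has no diagonal blocks. -/
theorem trace_projection_eq (hU : IsOpen U) (hUH : puncturedHalfPlane ⊆ U)
    (hPr : DifferentiableOn ℂ Pr U) (hid : ∀ z ∈ U, Pr z * Pr z = Pr z)
    {z z₀ : ℂ} (hz : z ∈ puncturedHalfPlane) (hz₀ : 0 < z₀.re) :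
    (Pr z).trace = (Pr z₀).trace := by
  let T : Matrix (Fin 4) (Fin 4) ℂ →L[ℂ] ℂ :=
    LinearMap.toContinuousLinearMap (Matrix.traceLinearMap (Fin 4) ℂ ℂ)
  have hd : ∀ t ∈ Icc (0 : ℝ) 1,
      HasDerivAt (fun t => T (Pr (segmentPath z z₀ t)) - T (Pr z₀)) 0 t := fun t ht => by
    have hwU := hUH (segmentPath_mem hz hz₀ ht)
    set w := segmentPath z z₀ t with hw
    have h1 : HasDerivAt Pr (deriv Pr w) w :=
      ((hPr w hwU).differentiableAt (hU.mem_nhds hwU)).hasDerivAt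
    have h2 : T (deriv Pr w) = 0 := by
      obtain ⟨h3, h4⟩ := mul_deriv_mul_eq_zero hU hPr hid hwU
      have h5 : (Pr w * deriv Pr w).trace = 0 := by
        rw [← hid w hwU, mul_assoc, Matrix.trace_mul_comm, mul_assoc, ← mul_assoc, h4,
          Matrix.trace_zero]
      show (deriv Pr w).trace = 0
      rw [← h3, Matrix.trace_add, Matrix.trace_mul_comm (deriv Pr w), h5, add_zero]
    have h6 : HasDerivAt (fun z => T (Pr z) - T (Pr z₀)) 0 w := by
      have := (T.hasFDerivAt.comp_hasDerivAt w h1).sub_const (T (Pr z₀))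
      exact this.congr_deriv h2
    exact (h6.scomp t (hasDerivAt_segmentPath z z₀ t)).congr_deriv (smul_zero _)
  have := eq_zero_iff_of_norm_deriv_le
    (f := fun t => T (Pr (segmentPath z z₀ t)) - T (Pr z₀)) (f' := fun _ => 0) (K := 0)
    (fun t ht => (hd t ht).continuousAt.continuousWithinAt)
    (fun t ht => hd t ⟨ht.1.le, ht.2⟩) (fun t _ => by simp)
  simp only [segmentPath_zero, segmentPath_one, sub_self, iff_true] at this
  exact sub_eq_zero.1 this

end Kato

/-- Differentiation under right multiplication by a constant matrix, for the entrywise topology, in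
which Kato's equation is stated. -/
theorem hasDerivAt_mul_const_rect {R : ℂ → Matrix (Fin 4) (Fin 2) ℂ}
    {R' : Matrix (Fin 4) (Fin 2) ℂ} {z : ℂ} (h : HasDerivAt R R' z)
    (C : Matrix (Fin 2) (Fin 4) ℂ) : HasDerivAt (fun z => R z * C) (R' * C) z := by
  have h1 : HasDerivAt (F := Fin 4 → Fin 2 → ℂ) R R' z := h
  have h2 : ∀ i j, HasDerivAt (fun z => R z i j) (R' i j) z := fun i j =>
    hasDerivAt_pi.1 (hasDerivAt_pi.1 h1 i) j
  have h3 : HasDerivAt (F := Fin 4 → Fin 4 → ℂ) (fun z => R z * C) (R' * C) z := by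
    refine hasDerivAt_pi.2 fun i => hasDerivAt_pi.2 fun j => ?_
    simp only [Matrix.mul_apply]
    exact HasDerivAt.fun_sum fun k _ => (h2 i k).mul_const (C k j)
  exact h3

theorem finrank_range_eq_of_trace {n : ℕ} {P : Matrix (Fin n) (Fin n) ℂ} (h : P * P = P) :
    P.trace = Module.finrank ℂ (LinearMap.range (Matrix.toLin' P)) := by
  have h1 : IsIdempotentElem (Matrix.toLin' P : Module.End ℂ (Fin n → ℂ)) := by
    show Matrix.toLin' P * Matrix.toLin' P = Matrix.toLin' P
    rw [Module.End.mul_eq_comp, ← Matrix.toLin'_mul, h]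
  rw [← Matrix.trace_toLin'_eq, (LinearMap.IsIdempotentElem.isProj_range _ h1).trace]

/-- The columns of a Kato basis for the stable projections of an affine family without imaginary
eigenvalues are a basis of the stable subspace, up to the boundary of the half-plane. -/
theorem IsKatoBasis.basis_stableSubspace {X Y : Matrix (Fin 4) (Fin 4) ℂ}
    (hyp : ∀ z ∈ puncturedHalfPlane, ∀ κ ∈ spectrum ℂ (X + z • Y), κ.re ≠ 0) {Λ : Set ℂ}
    (hΛ : puncturedHalfPlane ⊆ Λ) {R : ℂ → Matrix (Fin 4) (Fin 2) ℂ}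
    (hR : IsKatoBasis (fun z => stableProj (X + z • Y)) Λ R) {z : ℂ}
    (hz : z ∈ puncturedHalfPlane) :
    LinearIndependent ℂ (R z).col ∧
      Submodule.span ℂ (range (R z).col) = stableSubspace (X + z • Y) := by
  set U : Set ℂ := {z : ℂ | ∀ κ ∈ spectrum ℂ (X + z • Y), κ.re ≠ 0}
  have hU : IsOpen U := isOpen_spectrum_disjoint_imaginary X Y
  have hUH : puncturedHalfPlane ⊆ U := hyp
  set Pr : ℂ → Matrix (Fin 4) (Fin 4) ℂ := fun z => stableProj (X + z • Y)
  have hPr : DifferentiableOn ℂ Pr U := fun z hz =>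
    (differentiableAt_stableProj_affine hz).differentiableWithinAt
  have hid : ∀ z ∈ U, Pr z * Pr z = Pr z := fun z hz =>
    stableProj_mul_self (isCompl_stableSubspace hz)
  obtain ⟨z₀, hz₀, hind, hspan⟩ := hR.init
  have hz₀' : z₀ ∈ puncturedHalfPlane := ⟨hz₀.le, fun h0 => by simp [h0] at hz₀⟩
  -- Right multiplication by a fixed `2 × 4` matrix turns `R` into a square matrix function.
  have hmul : ∀ C : Matrix (Fin 2) (Fin 4) ℂ,
      (∀ z : ℂ, 0 < z.re → HasDerivAt (fun z => R z * C) (deriv Pr z * (R z * C)) z) ∧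
      ContinuousOn (fun z => R z * C) puncturedHalfPlane := fun C => by
    let L : Matrix (Fin 4) (Fin 2) ℂ →L[ℂ] Matrix (Fin 4) (Fin 4) ℂ :=
      LinearMap.toContinuousLinearMap
        { toFun := fun X => X * C
          map_add' := fun X Y => Matrix.add_mul X Y C
          map_smul' := fun c X => Matrix.smul_mul c X C }
    refine ⟨fun z hz => ?_, L.continuous.comp_continuousOn (hR.continuousOn.mono hΛ)⟩
    rw [← Matrix.mul_assoc]
    exact hasDerivAt_mul_const_rect (hR.ode z hz) C
  have hzero : ∀ c : Fin 2 → ℂ, ∀ w, (R w).mulVec c = 0 ↔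
      R w * Matrix.vecMulVec c (fun _ : Fin 4 => 1) = 0 := fun c w => by
    rw [Matrix.mul_vecMulVec]
    constructor
    · intro h; rw [h]; ext i j; simp [Matrix.vecMulVec_apply]
    · intro h; ext i
      simpa [Matrix.vecMulVec_apply] using congrFun (congrFun h i) 0
  have hli : LinearIndependent ℂ (R z).col := by
    rw [← Matrix.mulVec_injective_iff] at hind ⊢
    refine (injective_iff_map_eq_zero (R z).mulVecLin).2 fun c hc => ?_
    have h1 := kato_eq_zero hU hUH hPr (hmul _).1 (hmul _).2 hz hz₀ ((hzero c z).1 hc)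
    exact hind (by rw [(hzero c z₀).2 h1, Matrix.mulVec_zero])
  refine ⟨hli, ?_⟩
  have hcol : Pr z₀ * R z₀ = R z₀ := by
    ext i j
    have h1 : (R z₀).col j ∈ LinearMap.range (Matrix.toLin' (Pr z₀)) := by
      rw [← hspan]; exact Submodule.subset_span ⟨j, rfl⟩
    obtain ⟨y, hy⟩ := h1
    rw [Matrix.toLin'_apply] at hy
    have h2 : (Pr z₀).mulVec ((R z₀).col j) = (R z₀).col j := by
      rw [← hy, Matrix.mulVec_mulVec, hid z₀ (hUH hz₀')]
    exact congrFun h2 i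
  -- The factor `[1 0]` extends `R` by two zero columns.
  have hrange : Pr z * R z = R z := by
    have h1 := kato_mem_range hU hUH hPr hid
      (hmul (Matrix.of fun i j => if (j : ℕ) = i then 1 else 0)).1 (hmul _).2 hz hz₀
      (by rw [← Matrix.mul_assoc, hcol])
    rw [← Matrix.mul_assoc] at h1
    ext i j
    have h2 := congrFun (congrFun h1 i) (Fin.castLE (by norm_num) j)
    simpa [Matrix.mul_apply (M := R z), Matrix.mul_apply (M := Pr z * R z), ← Fin.ext_iff] using h2
  have hrk : Module.finrank ℂ (stableSubspace (X + z • Y)) = 2 := by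
    have h1 := trace_projection_eq hU hUH hPr hid hz hz₀
    rw [finrank_range_eq_of_trace (hid z (hUH hz)),
      finrank_range_eq_of_trace (hid z₀ (hUH hz₀')), ← hspan, finrank_span_eq_card hind,
      range_stableProj (isCompl_stableSubspace (hUH hz))] at h1
    exact_mod_cast h1
  refine Submodule.eq_of_le_of_finrank_eq ?_ ?_
  · rw [Submodule.span_le]
    rintro _ ⟨j, rfl⟩
    rw [← range_stableProj (isCompl_stableSubspace (hUH hz))]
    refine ⟨(R z).col j, ?_⟩
    rw [Matrix.toLin'_apply]
    ext i
    exact congrFun (congrFun hrange i) j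
  · rw [hrk, finrank_span_eq_card hli]
    simp

/-! ### The bivector of a stable subspace -/

section LeastBivector
open scoped Matrix.Norms.Operator

theorem pow_card_le_norm_prod {δ : ℝ} (hδ : 0 ≤ δ) (s : Multiset ℂ) (h : ∀ r ∈ s, δ ≤ ‖r‖) :
    δ ^ s.card ≤ ‖s.prod‖ := by
  induction s using Multiset.induction with
  | empty => simp
  | cons r s ih =>
    rw [Multiset.card_cons, Multiset.prod_cons, norm_mul, pow_succ, mul_comm]
    exact mul_le_mul (h r (Multiset.mem_cons_self r s))
      (ih fun x hx => h x (Multiset.mem_cons_of_mem hx)) (by positivity) (norm_nonneg _)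

/-- A lower bound for the real parts of the eigenvalues passes to the limit: if an eigenvalue `β` of
the limit violated it, then `det (β - f n)`, a product of factors `β - κ` with `κ` an eigenvalue of
`f n`, would stay away from `0`. -/
theorem le_re_eigenvalue_of_tendsto {V : Type*} [NormedAddCommGroup V] [NormedSpace ℂ V]
    [FiniteDimensional ℂ V] {f : ℕ → Module.End ℂ V} {g : Module.End ℂ V} {a : ℕ → ℝ} {a₀ : ℝ}
    (hf : ∀ v, Tendsto (fun n => f n v) atTop (𝓝 (g v))) (ha : Tendsto a atTop (𝓝 a₀))
    (hle : ∀ n (β : ℂ) (v : V), v ≠ 0 → f n v = β • v → a n ≤ β.re)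
    {β : ℂ} {v : V} (hv : v ≠ 0) (hβ : g v = β • v) : a₀ ≤ β.re := by
  by_contra! hlt
  set δ := (a₀ - β.re) / 2
  have hδ : 0 < δ := by simp only [δ]; linarith
  let b := Module.finBasis ℂ V
  set B : Module.End ℂ V → ℂ := fun h => (LinearMap.toMatrix b b (β • 1 - h)).det
  have h0 : B g = 0 := by
    refine Matrix.exists_mulVec_eq_zero_iff.1 ⟨b.repr v, fun h => hv ?_, ?_⟩
    · exact b.repr.map_eq_zero_iff.1 (DFunLike.coe_injective h)
    · rw [LinearMap.toMatrix_mulVec_repr]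
      simp [hβ]
  have hlim : Tendsto (fun n => B (f n)) atTop (𝓝 0) := by
    rw [← h0]
    have hc : Continuous fun M : Matrix (Fin (Module.finrank ℂ V)) (Fin (Module.finrank ℂ V)) ℂ =>
      M.det := Continuous.matrix_det continuous_id
    refine (hc.tendsto _).comp (tendsto_pi_nhds.2 fun i => tendsto_pi_nhds.2 fun j => ?_)
    simp only [LinearMap.toMatrix_apply]
    have hcoord : Continuous (b.coord i) := LinearMap.continuous_of_finiteDimensional _
    refine (hcoord.tendsto _).comp ?_
    exact tendsto_const_nhds.sub (hf (b j))
  have hbig : ∀ᶠ n in atTop, δ ^ Module.finrank ℂ V ≤ ‖B (f n)‖ := by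
    filter_upwards [ha.eventually (lt_mem_nhds (show a₀ - δ < a₀ by linarith))] with n hn
    set M := LinearMap.toMatrix b b (β • 1 - f n)
    have h1 : M.charpoly.roots.card = Module.finrank ℂ V := by
      rw [IsAlgClosed.card_roots_eq_natDegree, Matrix.charpoly_natDegree_eq_dim, Fintype.card_fin]
    show _ ≤ ‖M.det‖
    rw [Matrix.det_eq_prod_roots_charpoly]
    refine le_of_eq_of_le (congrArg (δ ^ ·) h1.symm) ?_
    refine pow_card_le_norm_prod hδ.le _ fun r hr => ?_
    have h2 : M.charpoly.IsRoot r := (Polynomial.mem_roots'.1 hr).2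
    rw [LinearMap.charpoly_toMatrix] at h2
    obtain ⟨w, hw, hw0⟩ :=
      ((Module.End.hasEigenvalue_iff_isRoot_charpoly _ _).2 h2).exists_hasEigenvector
    have h3 : f n w = (β - r) • w := by
      have := Module.End.mem_eigenspace_iff.1 hw
      simp only [LinearMap.sub_apply, LinearMap.smul_apply, Module.End.one_apply] at this
      rw [sub_smul, ← this]
      abel
    have h4 := hle n _ w hw0 h3
    rw [Complex.sub_re] at h4
    have h5 : β.re = a₀ - 2 * δ := by simp only [δ]; ring
    have h6 := (neg_le_abs r.re).trans (Complex.abs_re_le_norm r)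
    linarith
  have h1 : δ ^ Module.finrank ℂ V ≤ ‖(0 : ℂ)‖ := ge_of_tendsto hlim.norm hbig
  rw [norm_zero] at h1
  exact (pow_pos hδ _).not_ge h1

theorem norm_le_of_bivectorAction_eq {A ω : Matrix (Fin 4) (Fin 4) ℂ} {β : ℂ} (hω : ω ≠ 0)
    (h : bivectorAction A ω = β • ω) : ‖β‖ ≤ 5 * ‖A‖ := by
  have h1 : ‖β‖ * ‖ω‖ ≤ 5 * ‖A‖ * ‖ω‖ := by
    rw [← norm_smul, ← h, bivectorAction_apply]
    calc ‖A * ω + ω * A.transpose‖ ≤ ‖A‖ * ‖ω‖ + ‖ω‖ * ‖A.transpose‖ :=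
          (norm_add_le _ _).trans (add_le_add (norm_mul_le _ _) (norm_mul_le _ _))
      _ ≤ ‖A‖ * ‖ω‖ + ‖ω‖ * (4 * ‖A‖) := by gcongr; exact norm_transpose_le A
      _ = _ := by ring
  exact le_of_mul_le_mul_right h1 (norm_pos_iff.2 hω)

/-- Being a least bivector is a closed condition. To apply the semicontinuity of the spectrum, the
action on antisymmetric matrices is extended to symmetric ones as multiplication by `τ`. -/
theorem IsLeastBivector.of_tendsto {A η : ℕ → Matrix (Fin 4) (Fin 4) ℂ}
    {A₀ η₀ : Matrix (Fin 4) (Fin 4) ℂ} (hA : Tendsto A atTop (𝓝 A₀))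
    (hη : Tendsto η atTop (𝓝 η₀)) (h : ∀ n, IsLeastBivector (A n) (η n)) :
    IsLeastBivector A₀ η₀ := by
  -- The zero bivector is a least one for any `τ` below the spectrum of the action.
  by_cases hη₀ : η₀ = 0
  · refine ⟨-(5 * ‖A₀‖ : ℝ), by simp [hη₀], fun β ω _ hω hβ => ?_⟩
    rw [← Complex.ofReal_neg, Complex.ofReal_re]
    have h1 := norm_le_of_bivectorAction_eq hω hβ
    have h2 := (neg_le_abs β.re).trans (Complex.abs_re_le_norm β)
    linarith
  choose τ hτ hle using h
  have hev : ∀ᶠ n in atTop, τ n ∈ Metric.closedBall (0 : ℂ) (5 * (‖A₀‖ + 1)) := by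
    filter_upwards [hη.eventually_ne hη₀,
      hA.norm.eventually (gt_mem_nhds (show ‖A₀‖ < ‖A₀‖ + 1 by linarith))] with n h1 h2
    rw [mem_closedBall_zero_iff]
    exact (norm_le_of_bivectorAction_eq h1 (hτ n)).trans (by linarith)
  obtain ⟨t, -, φ, hφ, hlim⟩ :=
    tendsto_subseq_of_frequently_bounded Metric.isBounded_closedBall hev.frequently
  have hA' := hA.comp hφ.tendsto_atTop
  have hη' := hη.comp hφ.tendsto_atTop
  have htr : Continuous fun X : Matrix (Fin 4) (Fin 4) ℂ => X.transpose :=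
    continuous_id.matrix_transpose
  refine ⟨t, ?_, fun β ω hω hω0 hβ => ?_⟩
  · have h1 : Tendsto (fun n => bivectorAction (A (φ n)) (η (φ n))) atTop
        (𝓝 (bivectorAction A₀ η₀)) := by
      simp only [bivectorAction_apply]
      exact (hA'.mul hη').add (hη'.mul ((htr.tendsto _).comp hA'))
    have h2 : Tendsto (fun n => bivectorAction (A (φ n)) (η (φ n))) atTop (𝓝 (t • η₀)) := by
      simp only [hτ]
      exact hlim.smul hη'
    exact tendsto_nhds_unique h1 h2
  · let anti : Module.End ℂ (Matrix (Fin 4) (Fin 4) ℂ) :=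
      (2⁻¹ : ℂ) • (LinearMap.id - (Matrix.transposeLinearEquiv (Fin 4) (Fin 4) ℂ ℂ).toLinearMap)
    let sym : Module.End ℂ (Matrix (Fin 4) (Fin 4) ℂ) :=
      (2⁻¹ : ℂ) • (LinearMap.id + (Matrix.transposeLinearEquiv (Fin 4) (Fin 4) ℂ ℂ).toLinearMap)
    have hanti : ∀ X, anti X = (2⁻¹ : ℂ) • (X - X.transpose) := fun X => rfl
    have hsym : ∀ X, sym X = (2⁻¹ : ℂ) • (X + X.transpose) := fun X => rfl
    have hsum : ∀ X, anti X + sym X = X := fun X => by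
      rw [hanti, hsym, ← smul_add, sub_add_add_cancel, ← two_smul ℂ X, smul_smul]
      norm_num
    let ext : Matrix (Fin 4) (Fin 4) ℂ → ℂ → Module.End ℂ (Matrix (Fin 4) (Fin 4) ℂ) :=
      fun A s => bivectorAction A ∘ₗ anti + s • sym
    have hext : ∀ A s X, ext A s X = bivectorAction A (anti X) + s • sym X := fun A s X => rfl
    have hantiω : anti ω = ω := by
      rw [hanti, hω, sub_neg_eq_add, ← two_smul ℂ ω, smul_smul]; norm_num
    have hsymω : sym ω = 0 := by rw [hsym, hω, add_neg_cancel, smul_zero]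
    refine le_re_eigenvalue_of_tendsto (f := fun n => ext (A (φ n)) (τ (φ n))) (g := ext A₀ t)
      (a := fun n => (τ (φ n)).re) (fun X => ?_) ((Complex.continuous_re.tendsto t).comp hlim)
      (fun n γ X hX hγ => ?_) hω0 (by rw [hext, hantiω, hsymω, smul_zero, add_zero, hβ])
    · simp only [hext, bivectorAction_apply]
      exact ((hA'.mul_const _).add ((htr.tendsto _).comp hA' |>.const_mul _)).add
        (hlim.smul_const _)
    · rw [hext] at hγ
      -- The antisymmetric and the symmetric parts of `X` satisfy the equation separately.
      have hat : (anti X).transpose = -anti X := by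
        rw [hanti, Matrix.transpose_smul, Matrix.transpose_sub, Matrix.transpose_transpose,
          ← smul_neg, neg_sub]
      have hst : (sym X).transpose = sym X := by
        rw [hsym, Matrix.transpose_smul, Matrix.transpose_add, Matrix.transpose_transpose, add_comm]
      have hγ' : bivectorAction (A (φ n)) (anti X) + τ (φ n) • sym X =
          γ • anti X + γ • sym X := by
        rw [hγ, ← smul_add, hsum]
      have hγt : -bivectorAction (A (φ n)) (anti X) + τ (φ n) • sym X =
          -(γ • anti X) + γ • sym X := by
        have h1 := congrArg Matrix.transpose hγ'
        simp only [bivectorAction_apply, Matrix.transpose_add, Matrix.transpose_smul,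
          Matrix.transpose_mul, Matrix.transpose_transpose, hat, hst] at h1
        rw [bivectorAction_apply, neg_add, add_comm (-(A (φ n) * anti X))]
        simpa using h1
      have hsplit : ∀ a b c d : Matrix (Fin 4) (Fin 4) ℂ, a + b = c + d → -a + b = -c + d →
          (2 : ℂ) • a = (2 : ℂ) • c ∧ (2 : ℂ) • b = (2 : ℂ) • d := fun a b c d h1 h2 => by
        have h3 : a + a = (a + b) - (-a + b) := by abel
        have h4 : b + b = (a + b) + (-a + b) := by abel
        simp only [two_smul]
        rw [h3, h4, h1, h2]
        constructor <;> abel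
      obtain ⟨h2, h3⟩ := hsplit _ _ _ _ hγ' hγt
      have h2' := smul_right_injective _ (two_ne_zero (α := ℂ)) h2
      have h3' := smul_right_injective _ (two_ne_zero (α := ℂ)) h3
      by_cases ha : anti X = 0
      · have hs : sym X ≠ 0 := fun hs => hX (by rw [← hsum X, ha, hs, add_zero])
        rw [smul_left_injective ℂ hs h3']
      · exact hle _ γ _ hat ha h2'

theorem re_neg_of_mem_stableSubspace {n : ℕ} {M : Matrix (Fin n) (Fin n) ℂ}
    (hM : ∀ κ ∈ spectrum ℂ M, κ.re ≠ 0) {x : Fin n → ℂ} (hx : x ∈ stableSubspace M) (hx0 : x ≠ 0)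
    {m : ℂ} (h : M.mulVec x = m • x) : m.re < 0 := by
  have h1 : x ∈ Module.End.maxGenEigenspace (Matrix.toLin' M) m :=
    Module.End.eigenspace_le_maxGenEigenspace
      (Module.End.mem_eigenspace_iff.2 (by rw [Matrix.toLin'_apply, h]))
  by_contra! hm
  refine hx0 ?_
  rcases hm.eq_or_lt with h2 | h2
  · exact eq_zero_of_mem_maxGenEigenspace (fun h' => hM m h' h2.symm) h1
  · have h3 : x ∈ unstableSubspace M :=
      Submodule.mem_iSup_of_mem m (Submodule.mem_iSup_of_mem h2 h1)
    exact Submodule.disjoint_def.1 (isCompl_stableSubspace hM).disjoint x hx h3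

theorem re_pos_of_mem_unstableSubspace {n : ℕ} {M : Matrix (Fin n) (Fin n) ℂ}
    (hM : ∀ κ ∈ spectrum ℂ M, κ.re ≠ 0) {x : Fin n → ℂ} (hx : x ∈ unstableSubspace M)
    (hx0 : x ≠ 0) {m : ℂ} (h : M.mulVec x = m • x) : 0 < m.re := by
  have h1 : x ∈ Module.End.maxGenEigenspace (Matrix.toLin' M) m :=
    Module.End.eigenspace_le_maxGenEigenspace
      (Module.End.mem_eigenspace_iff.2 (by rw [Matrix.toLin'_apply, h]))
  by_contra! hm
  refine hx0 ?_
  rcases hm.eq_or_lt with h2 | h2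
  · exact eq_zero_of_mem_maxGenEigenspace (fun h' => hM m h' h2) h1
  · have h3 : x ∈ stableSubspace M :=
      Submodule.mem_iSup_of_mem m (Submodule.mem_iSup_of_mem h2 h1)
    exact Submodule.disjoint_def.1 (isCompl_stableSubspace hM).disjoint x h3 hx

/-- Left and right multiplication commute, so an eigenvector of `X ↦ M X + X Mᵀ` in the range of
`X ↦ P X Qᵀ` can be replaced by a common eigenvector of the two multiplications. -/
theorem exists_common_eigenvector {M P Q : Matrix (Fin 4) (Fin 4) ℂ} (hP : M * P = P * M)
    {β : ℂ} {X : Matrix (Fin 4) (Fin 4) ℂ} (hX : X ≠ 0) (hPX : P * X = X)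
    (hXQ : X * Q.transpose = X) (hβ : bivectorAction M X = β • X) :
    ∃ (m : ℂ) (Z : Matrix (Fin 4) (Fin 4) ℂ), Z ≠ 0 ∧ P * Z = Z ∧ Z * Q.transpose = Z ∧
      M * Z = m • Z ∧ Z * M.transpose = (β - m) • Z := by
  let W : Submodule ℂ (Matrix (Fin 4) (Fin 4) ℂ) :=
    { carrier := {Z | P * Z = Z ∧ Z * Q.transpose = Z ∧ bivectorAction M Z = β • Z}
      add_mem' := fun {a b} ha hb =>
        ⟨by rw [mul_add, ha.1, hb.1], by rw [add_mul, ha.2.1, hb.2.1],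
          by rw [map_add, ha.2.2, hb.2.2, smul_add]⟩
      zero_mem' := ⟨by simp, by simp, by simp⟩
      smul_mem' := fun c a ha =>
        ⟨by rw [Matrix.mul_smul, ha.1], by rw [Matrix.smul_mul, ha.2.1],
          by rw [map_smul, ha.2.2, smul_comm]⟩ }
  have hW : ∀ a ∈ W, LinearMap.mulLeft ℂ M a ∈ W := fun a ha => by
    refine ⟨?_, ?_, ?_⟩
    · rw [LinearMap.mulLeft_apply, ← mul_assoc, ← hP, mul_assoc, ha.1]
    · rw [LinearMap.mulLeft_apply, mul_assoc, ha.2.1]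
    · have h1 := ha.2.2
      rw [bivectorAction_apply] at h1
      rw [LinearMap.mulLeft_apply, bivectorAction_apply, mul_assoc, ← mul_add, h1, Matrix.mul_smul]
  have : Nontrivial W := ⟨⟨⟨X, hPX, hXQ, hβ⟩, 0, fun h => hX (congrArg Subtype.val h)⟩⟩
  obtain ⟨m, hm⟩ := Module.End.exists_eigenvalue ((LinearMap.mulLeft ℂ M).restrict hW)
  obtain ⟨⟨Z, hZ⟩, hZm, hZ0⟩ := hm.exists_hasEigenvector
  have h1 : M * Z = m • Z := by
    simpa using congrArg Subtype.val (Module.End.mem_eigenspace_iff.1 hZm)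
  refine ⟨m, Z, fun h => hZ0 (Subtype.ext h), hZ.1, hZ.2.1, h1, ?_⟩
  have h2 := hZ.2.2
  rw [bivectorAction_apply, h1] at h2
  rw [sub_smul, ← h2]
  abel

theorem exists_col_eigenvector {M P Z : Matrix (Fin 4) (Fin 4) ℂ} {m : ℂ} (hZ : Z ≠ 0)
    (hP : P * Z = Z) (hM : M * Z = m • Z) :
    ∃ x : Fin 4 → ℂ, x ≠ 0 ∧ P.mulVec x = x ∧ M.mulVec x = m • x := by
  obtain ⟨j, hj⟩ : ∃ j, Z.col j ≠ 0 := by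
    by_contra! h
    exact hZ (by ext i j; exact congrFun (h j) i)
  exact ⟨Z.col j, hj, funext fun i => congrFun (congrFun hP i) j,
    funext fun i => congrFun (congrFun hM i) j⟩

theorem exists_mul_eq_of_col_mem {k : ℕ} {R : Matrix (Fin 4) (Fin 2) ℂ}
    {Y : Matrix (Fin 4) (Fin k) ℂ} (h : ∀ j, Y.col j ∈ Submodule.span ℂ (range R.col)) :
    ∃ L : Matrix (Fin 2) (Fin k) ℂ, Y = R * L := by
  simp only [← Matrix.range_mulVecLin, LinearMap.mem_range, Matrix.mulVecLin_apply] at h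
  choose c hc using h
  refine ⟨Matrix.of fun i j => c j i, ?_⟩
  ext i j
  exact (congrFun (hc j) i).symm

/-- The bivector of a basis of the stable subspace is an eigenvector of the action on bivectors, for
the sum of the two stable eigenvalues. Any other eigenvalue is a sum of two eigenvalues at least
one of which is unstable. -/
theorem isLeastBivector_of_basis {M : Matrix (Fin 4) (Fin 4) ℂ}
    (hM : ∀ κ ∈ spectrum ℂ M, κ.re ≠ 0) {R : Matrix (Fin 4) (Fin 2) ℂ}
    (hli : LinearIndependent ℂ R.col)
    (hspan : Submodule.span ℂ (range R.col) = stableSubspace M) :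
    IsLeastBivector M (bivector R) := by
  have hcompl := isCompl_stableSubspace hM
  have hinj : Function.Injective R.mulVec := Matrix.mulVec_injective_iff.2 hli
  have hRmem : ∀ c, R.mulVec c ∈ stableSubspace M := fun c => by
    rw [← hspan, ← Matrix.range_mulVecLin]
    exact ⟨c, rfl⟩
  obtain ⟨N, hN⟩ : ∃ N : Matrix (Fin 2) (Fin 2) ℂ, M * R = R * N := by
    refine exists_mul_eq_of_col_mem fun j => ?_
    rw [hspan]
    exact mulVec_mem_stableSubspace (hspan ▸ Submodule.subset_span ⟨j, rfl⟩ : R.col j ∈ _)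
  have hNneg : ∀ (m : ℂ) (c : Fin 2 → ℂ), c ≠ 0 → N.mulVec c = m • c → m.re < 0 := by
    intro m c hc hNc
    refine re_neg_of_mem_stableSubspace hM (hRmem c)
      (fun h => hc (hinj (by rw [h, Matrix.mulVec_zero]))) ?_
    rw [Matrix.mulVec_mulVec, hN, ← Matrix.mulVec_mulVec, hNc, Matrix.mulVec_smul]
  -- If `m` is one of the two stable eigenvalues, then `tr N - m` is the other one.
  have hother : ∀ (m : ℂ) (c : Fin 2 → ℂ), c ≠ 0 → N.mulVec c = m • c → (N.trace - m).re < 0 := by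
    intro m c hc hNc
    have h1 : (N - m • 1).det = 0 := Matrix.exists_mulVec_eq_zero_iff.1 ⟨c, hc, by
      rw [Matrix.sub_mulVec, hNc, Matrix.smul_mulVec, Matrix.one_mulVec, sub_self]⟩
    have h2 : (N - (N.trace - m) • 1).det = 0 := by
      rw [← h1, Matrix.det_fin_two, Matrix.det_fin_two]
      simp [Matrix.trace_fin_two]
      ring
    obtain ⟨c', hc', hNc'⟩ := Matrix.exists_mulVec_eq_zero_iff.2 h2
    rw [Matrix.sub_mulVec, Matrix.smul_mulVec, Matrix.one_mulVec, sub_eq_zero] at hNc'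
    exact hNneg _ c' hc' hNc'
  have heig : bivectorAction M (bivector R) = N.trace • bivector R := by
    set J : Matrix (Fin 2) (Fin 2) ℂ := !![0, 1; -1, 0]
    have h1 : N * J + J * N.transpose = N.trace • J := by
      ext i j
      fin_cases i <;> fin_cases j <;>
        simp [J, Matrix.mul_apply, Matrix.vecMul, dotProduct, Fin.sum_univ_two,
          Matrix.trace_fin_two]
    have h2 : bivectorAction M (bivector R) = R * (N * J + J * N.transpose) * R.transpose := by
      have h3 : R.transpose * M.transpose = N.transpose * R.transpose := by
        rw [← Matrix.transpose_mul, hN, Matrix.transpose_mul]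
      rw [bivectorAction_apply, bivector, Matrix.mul_add, Matrix.add_mul]
      congr 1
      · rw [← Matrix.mul_assoc, ← Matrix.mul_assoc, hN, Matrix.mul_assoc R N]
      · rw [Matrix.mul_assoc, h3]
        simp only [J, Matrix.mul_assoc]
    rw [h2, h1, Matrix.mul_smul, Matrix.smul_mul]
    rfl
  refine ⟨N.trace, heig, fun β ω hω hω0 hβ => ?_⟩
  set P := stableProj M
  have hPP : P * P = P := stableProj_mul_self hcompl
  have hMP : M * P = P * M := stableProj_commute hcompl
  have hPmem : ∀ x, P.mulVec x ∈ stableSubspace M := fun x => by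
    rw [← range_stableProj hcompl]
    exact ⟨x, Matrix.toLin'_apply _ _⟩
  have hQmem : ∀ x, P.mulVec x = 0 → x ∈ unstableSubspace M := fun x hx => by
    have h1 : stableProj M = LinearMap.toMatrix' ((stableSubspace M).projection _ hcompl) :=
      dif_pos hcompl
    rw [← Submodule.projection_apply_eq_zero_iff hcompl, ← LinearMap.toMatrix'_mulVec, ← h1, hx]
  set Q := 1 - P
  have hQQ : Q * Q = Q := by simp only [Q]; rw [mul_sub, sub_mul, sub_mul, hPP]; simp
  have hMQ : M * Q = Q * M := by simp only [Q]; rw [mul_sub, sub_mul, hMP]; simp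
  have hQx : ∀ x, Q.mulVec x = x → x ∈ unstableSubspace M := fun x hx => hQmem x (by
    simpa [Q, Matrix.sub_mulVec] using hx)
  have hPt : P.transpose * P.transpose = P.transpose := by rw [← Matrix.transpose_mul, hPP]
  have hQt : Q.transpose * Q.transpose = Q.transpose := by rw [← Matrix.transpose_mul, hQQ]
  -- The four blocks of `ω` satisfy the eigenvalue equation separately.
  have hblock : ∀ S T : Matrix (Fin 4) (Fin 4) ℂ, M * S = S * M → M * T = T * M →
      bivectorAction M (S * ω * T.transpose) = β • (S * ω * T.transpose) := by
    intro S T hS hT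
    have hT' : T.transpose * M.transpose = M.transpose * T.transpose := by
      rw [← Matrix.transpose_mul, ← Matrix.transpose_mul, hT]
    calc bivectorAction M (S * ω * T.transpose)
        = (M * S) * ω * T.transpose + S * ω * (T.transpose * M.transpose) := by
          rw [bivectorAction_apply]; simp only [mul_assoc]
      _ = S * (bivectorAction M ω) * T.transpose := by
          rw [hS, hT', bivectorAction_apply]; noncomm_ring
      _ = _ := by rw [hβ, Matrix.mul_smul, Matrix.smul_mul]
  have hcolN : ∀ (m : ℂ) (x : Fin 4 → ℂ), x ≠ 0 → P.mulVec x = x → M.mulVec x = m • x →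
      ∃ c, c ≠ 0 ∧ N.mulVec c = m • c := by
    intro m x hx hPx hMx
    have h1 : x ∈ Submodule.span ℂ (range R.col) := by rw [hspan, ← hPx]; exact hPmem x
    rw [← Matrix.range_mulVecLin] at h1
    obtain ⟨c, hc⟩ := h1
    rw [Matrix.mulVecLin_apply] at hc
    refine ⟨c, fun h => hx (by rw [← hc, h, Matrix.mulVec_zero]), hinj ?_⟩
    rw [Matrix.mulVec_mulVec, ← hN, ← Matrix.mulVec_mulVec, hc, hMx, Matrix.mulVec_smul, hc]
  by_cases h12 : P * ω * Q.transpose = 0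
  · have h21 : Q * ω * P.transpose = 0 := by
      have h1 := congrArg Matrix.transpose h12
      rw [Matrix.transpose_mul, Matrix.transpose_mul, Matrix.transpose_transpose, hω, neg_mul,
        mul_neg, Matrix.transpose_zero, neg_eq_zero, ← mul_assoc] at h1
      exact h1
    by_cases h22 : Q * ω * Q.transpose = 0
    · -- Here `ω` is a multiple of the bivector of `R`.
      have h1 : ω = P * ω * P.transpose := by
        have h2 : ω = (P + Q) * ω * (P + Q).transpose := by simp [Q]
        rw [Matrix.transpose_add] at h2
        calc ω = P * ω * P.transpose + P * ω * Q.transpose + Q * ω * P.transpose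
              + Q * ω * Q.transpose := by conv_lhs => rw [h2]
                                          noncomm_ring
          _ = _ := by rw [h12, h21, h22]; simp
      obtain ⟨L, hL⟩ : ∃ L : Matrix (Fin 2) (Fin 4) ℂ, P = R * L := by
        refine exists_mul_eq_of_col_mem fun j => ?_
        rw [hspan, ← Matrix.mulVec_single_one]
        exact hPmem _
      set C := L * ω * L.transpose
      have hC : C.transpose = -C := by
        simp only [C, Matrix.transpose_mul, Matrix.transpose_transpose, hω]
        rw [Matrix.neg_mul, Matrix.mul_neg, Matrix.mul_assoc]
      have hCJ : C = C 0 1 • !![0, 1; -1, 0] := by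
        have h2 : ∀ i j, C j i = -C i j := fun i j => congrFun (congrFun hC i) j
        have h3 : ∀ i, C i i = 0 := fun i => self_eq_neg.1 (h2 i i)
        ext i j
        fin_cases i <;> fin_cases j <;> simp [h3, h2 0 1]
      have h2 : ω = C 0 1 • bivector R := by
        have h3 : ω = R * C * R.transpose := by
          conv_lhs => rw [h1, hL]
          simp only [C, Matrix.transpose_mul, Matrix.mul_assoc]
        rw [h3, hCJ, Matrix.mul_smul, Matrix.smul_mul]
        simp [bivector]
      have h3 : N.trace • ω = β • ω := by
        rw [← hβ, h2, map_smul, heig, smul_comm]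
      rw [smul_left_injective ℂ hω0 h3]
    · obtain ⟨m, Z, hZ, hQZ, hZQ, hMZ, hZM⟩ := exists_common_eigenvector (P := Q) (Q := Q) hMQ h22
        (by rw [← mul_assoc, ← mul_assoc, hQQ]) (by rw [mul_assoc, hQt]) (hblock Q Q hMQ hMQ)
      obtain ⟨x, hx, hQx', hMx⟩ := exists_col_eigenvector hZ hQZ hMZ
      obtain ⟨y, hy, hQy, hMy⟩ := exists_col_eigenvector (M := M) (P := Q) (Z := Z.transpose)
        (m := β - m)
        (fun h => hZ (by rw [← Matrix.transpose_transpose Z, h, Matrix.transpose_zero]))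
        (by rw [← Matrix.transpose_transpose Q, ← Matrix.transpose_mul, hZQ])
        (by rw [← Matrix.transpose_transpose M, ← Matrix.transpose_mul, hZM,
          Matrix.transpose_smul])
      have h1 := re_pos_of_mem_unstableSubspace hM (hQx x hQx') hx hMx
      have h2 := re_pos_of_mem_unstableSubspace hM (hQx y hQy) hy hMy
      obtain ⟨s, hs⟩ := Module.End.exists_eigenvalue (Matrix.toLin' N : Module.End ℂ (Fin 2 → ℂ))
      obtain ⟨c, hc, hc0⟩ := hs.exists_hasEigenvector
      have hc' : N.mulVec c = s • c := by
        rw [← Matrix.toLin'_apply]; exact Module.End.mem_eigenspace_iff.1 hc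
      have h3 := hNneg s c hc0 hc'
      have h4 := hother s c hc0 hc'
      rw [Complex.sub_re] at h2 h4
      linarith
  · obtain ⟨m, Z, hZ, hPZ, hZQ, hMZ, hZM⟩ := exists_common_eigenvector (P := P) (Q := Q) hMP h12
      (by rw [← mul_assoc, ← mul_assoc, hPP]) (by rw [mul_assoc, hQt]) (hblock P Q hMP hMQ)
    obtain ⟨x, hx, hPx, hMx⟩ := exists_col_eigenvector hZ hPZ hMZ
    obtain ⟨y, hy, hQy, hMy⟩ := exists_col_eigenvector (M := M) (P := Q) (Z := Z.transpose)
      (m := β - m)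
      (fun h => hZ (by rw [← Matrix.transpose_transpose Z, h, Matrix.transpose_zero]))
      (by rw [← Matrix.transpose_transpose Q, ← Matrix.transpose_mul, hZQ])
      (by rw [← Matrix.transpose_transpose M, ← Matrix.transpose_mul, hZM,
        Matrix.transpose_smul])
    obtain ⟨c, hc0, hc⟩ := hcolN m x hx hPx hMx
    have h1 := hother m c hc0 hc
    have h2 := re_pos_of_mem_unstableSubspace hM (hQx y hQy) hy hMy
    rw [Complex.sub_re] at h1 h2
    linarith

end LeastBivector

/-! ### The coefficient matrix and the reduced Evans function -/

section Assembly
open scoped Matrix.Norms.Operator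

/-- The coefficient of the frequency in the coefficient matrix. -/
def coeffSlope (v : ℝ) : Matrix (Fin 4) (Fin 4) ℂ :=
  !![0, 0, 0, 0; (v : ℂ), 0, 0, 0; 0, 0, 0, 0; 0, 0, (v : ℂ), 0]

theorem coeffMatrix_eq (μ₀ σ B v : ℝ) (z : ℂ) :
    coeffMatrix μ₀ σ B v z = coeffMatrix μ₀ σ B v 0 + z • coeffSlope v := by
  ext i j
  fin_cases i <;> fin_cases j <;> simp [coeffMatrix, coeffSlope]

theorem neg_coeffMatrix_eq (μ₀ σ B v : ℝ) (z : ℂ) :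
    -coeffMatrix μ₀ σ B v z = -coeffMatrix μ₀ σ B v 0 + z • (-coeffSlope v) := by
  rw [coeffMatrix_eq, neg_add, smul_neg]

theorem eq_zero_of_mul_sq_add_sq_eq_zero {m a b c d : ℝ} (hm : 0 < m)
    (h : m * (a ^ 2 + b ^ 2) + (c ^ 2 + d ^ 2) = 0) : a = 0 ∧ b = 0 ∧ c = 0 ∧ d = 0 := by
  have h1 : 0 ≤ m * (a ^ 2 + b ^ 2) := by positivity
  have h2 : m * (a ^ 2 + b ^ 2) = 0 := by linarith [sq_nonneg c, sq_nonneg d]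
  have h3 := (mul_eq_zero.1 h2).resolve_left hm.ne'
  refine ⟨?_, ?_, ?_, ?_⟩ <;> refine pow_eq_zero_iff two_ne_zero |>.1 (le_antisymm ?_ (sq_nonneg _))
  all_goals linarith [sq_nonneg a, sq_nonneg b, sq_nonneg c, sq_nonneg d]

/-- For `0 ≤ Re z`, `z ≠ 0`, no eigenvalue of the coefficient matrix is imaginary. For an
eigenvalue `i k`, `k ≠ 0`, with eigenvector `(w, i k w, α, ·)`, testing the two second-order
equations against `w` and `α` removes the coupling terms and gives `Re z` times a positive form in
`(w, α)` equal to `-k²` times another one. The eigenvalue `0` is excluded by `z ≠ 0`. -/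
theorem re_ne_zero_of_mem_spectrum_coeffMatrix {μ₀ σ B v : ℝ} (hμ₀ : 0 < μ₀) (hσ : 0 < σ)
    (hv : 0 < v) {z : ℂ} (hz : z ∈ puncturedHalfPlane) {κ : ℂ}
    (hκ : κ ∈ spectrum ℂ (coeffMatrix μ₀ σ B v z)) : κ.re ≠ 0 := by
  intro hre
  rw [← Matrix.spectrum_toLin', ← Module.End.hasEigenvalue_iff_mem_spectrum] at hκ
  obtain ⟨x, hx, hx0⟩ := hκ.exists_hasEigenvector
  have hx' : (coeffMatrix μ₀ σ B v z).mulVec x = κ • x := by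
    rw [← Matrix.toLin'_apply]; exact Module.End.mem_eigenspace_iff.1 hx
  have e0 : x 1 = κ * x 0 := by
    simpa [coeffMatrix, Matrix.mulVec, dotProduct, Fin.sum_univ_four] using congrFun hx' 0
  have e1 : z * v * x 0 + v * x 1 + -(σ * B * v) * x 3 = κ * x 1 := by
    simpa [coeffMatrix, Matrix.mulVec, dotProduct, Fin.sum_univ_four] using congrFun hx' 1
  have e2 : σ * μ₀ * v * x 3 = κ * x 2 := by
    simpa [coeffMatrix, Matrix.mulVec, dotProduct, Fin.sum_univ_four] using congrFun hx' 2
  have e3 : -(B * v) * x 1 + z * v * x 2 + σ * μ₀ * v ^ 2 * x 3 = κ * x 3 := by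
    simpa [coeffMatrix, Matrix.mulVec, dotProduct, Fin.sum_univ_four] using congrFun hx' 3
  have hσμv : (σ * μ₀ * v : ℂ) ≠ 0 := by
    exact_mod_cast (by positivity : σ * μ₀ * v ≠ 0)
  have hzero : ¬ (x 0 = 0 ∧ x 2 = 0) := by
    rintro ⟨h0, h2⟩
    have h1 : x 1 = 0 := by rw [e0, h0, mul_zero]
    have h3 : x 3 = 0 := by
      rw [h2, mul_zero] at e2
      exact (mul_eq_zero.1 e2).resolve_left hσμv
    exact hx0 (funext fun i => by fin_cases i <;> assumption)
  by_cases hk : κ = 0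
  · have hzv : z * v ≠ 0 := mul_ne_zero hz.2 (by exact_mod_cast hv.ne')
    have h1 : x 1 = 0 := by rw [e0, hk, zero_mul]
    have h3 : x 3 = 0 := by
      rw [hk, zero_mul] at e2
      exact (mul_eq_zero.1 e2).resolve_left hσμv
    refine hzero ⟨?_, ?_⟩
    · rw [h1, h3] at e1
      have : z * v * x 0 = 0 := by simpa using e1
      exact (mul_eq_zero.1 this).resolve_left hzv
    · rw [h1, h3] at e3
      have : z * v * x 2 = 0 := by simpa using e3
      exact (mul_eq_zero.1 this).resolve_left hzv
  · have hA : μ₀ * v * (z + κ) * x 0 - B * κ * x 2 = μ₀ * κ ^ 2 * x 0 := by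
      linear_combination μ₀ * e1 + B * e2 - (μ₀ * v - μ₀ * κ) * e0
    have hB : σ * μ₀ * v ^ 2 * ((z + κ) * x 2 - B * κ * x 0) = κ ^ 2 * x 2 := by
      linear_combination (σ * μ₀ * v) * e3 + (κ - σ * μ₀ * v ^ 2) * e2 +
        (σ * μ₀ * v * B * v) * e0
    obtain ⟨hz0, -⟩ := hz
    have hk' : κ.im ≠ 0 := fun h => hk (Complex.ext hre h)
    have hAre := congrArg Complex.re hA
    have hAim := congrArg Complex.im hA
    have hBre := congrArg Complex.re hB
    have hBim := congrArg Complex.im hB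
    simp only [pow_two, Complex.sub_re, Complex.sub_im, Complex.mul_re, Complex.mul_im,
      Complex.add_re, Complex.add_im, Complex.ofReal_re, Complex.ofReal_im, hre] at *
    set a0 := (x 0).re
    set b0 := (x 0).im
    set a2 := (x 2).re
    set b2 := (x 2).im
    set k := κ.im
    have key : σ * μ₀ * v ^ 2 * (z.re * (μ₀ * v * (a0 ^ 2 + b0 ^ 2) + (a2 ^ 2 + b2 ^ 2))) +
        k ^ 2 * (σ * μ₀ ^ 2 * v ^ 2 * (a0 ^ 2 + b0 ^ 2) + (a2 ^ 2 + b2 ^ 2)) = 0 := by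
      linear_combination σ * μ₀ * v ^ 2 * (a0 * hAre + b0 * hAim) + (a2 * hBre + b2 * hBim)
    have h1 : 0 ≤ σ * μ₀ * v ^ 2 *
        (z.re * (μ₀ * v * (a0 ^ 2 + b0 ^ 2) + (a2 ^ 2 + b2 ^ 2))) := by positivity
    have hk2 : 0 < k ^ 2 := by positivity
    have h2 : σ * μ₀ ^ 2 * v ^ 2 * (a0 ^ 2 + b0 ^ 2) + (a2 ^ 2 + b2 ^ 2) = 0 := by
      have h3 : 0 ≤ σ * μ₀ ^ 2 * v ^ 2 * (a0 ^ 2 + b0 ^ 2) + (a2 ^ 2 + b2 ^ 2) := by positivity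
      by_contra hne
      have := mul_pos hk2 (lt_of_le_of_ne h3 (Ne.symm hne))
      linarith
    have h4 : 0 < σ * μ₀ ^ 2 * v ^ 2 := by positivity
    obtain ⟨ha0, hb0, ha2, hb2⟩ := eq_zero_of_mul_sq_add_sq_eq_zero h4 h2
    exact hzero ⟨Complex.ext ha0 hb0, Complex.ext ha2 hb2⟩

theorem continuous_coeffMatrix (μ₀ σ B : ℝ) :
    Continuous fun p : ℝ × ℂ => coeffMatrix μ₀ σ B p.1 p.2 := by
  refine continuous_matrix fun i j => ?_
  fin_cases i <;> fin_cases j <;> simp [coeffMatrix] <;> fun_prop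

theorem norm_coeffMatrix_sub_le {μ₀ σ B b Z : ℝ} (hμ₀ : 0 < μ₀) (hσ : 0 < σ) (hB : 0 ≤ B)
    {v w : ℝ} (hv : |v| ≤ b) (hw : |w| ≤ b) {z : ℂ} (hz : ‖z‖ ≤ Z) :
    ‖coeffMatrix μ₀ σ B v z - coeffMatrix μ₀ σ B w z‖ ≤
      4 * ((Z + 1 + σ * B + σ * μ₀ + B + σ * μ₀ * (2 * b)) * |v - w|) := by
  have hb : 0 ≤ b := (abs_nonneg v).trans hv
  have hZ : 0 ≤ Z := (norm_nonneg z).trans hz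
  set L := Z + 1 + σ * B + σ * μ₀ + B + σ * μ₀ * (2 * b) with hL
  have hσμ : 0 < σ * μ₀ := by positivity
  have hσB : 0 ≤ σ * B := by positivity
  have hσb : 0 ≤ σ * μ₀ * (2 * b) := by positivity
  have key : ∀ (c : ℂ), ‖c‖ ≤ L → ‖c * v - c * w‖ ≤ L * |v - w| := fun c hc => by
    rw [← mul_sub, norm_mul, ← Complex.ofReal_sub, Complex.norm_real, Real.norm_eq_abs]
    gcongr
  have hreal : ∀ c : ℝ, 0 ≤ c → ‖(c : ℂ)‖ = c := fun c hc => by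
    rw [Complex.norm_real, Real.norm_eq_abs, abs_of_nonneg hc]
  have h0 : 0 ≤ L * |v - w| := by positivity
  refine norm_le_of_entries_le fun i j => ?_
  have k1 := key z (by linarith)
  have k2 := key 1 (by rw [norm_one]; linarith)
  have k3 := key (σ * B : ℝ) (by rw [hreal _ hσB]; linarith)
  have k4 := key (σ * μ₀ : ℝ) (by rw [hreal _ hσμ.le]; linarith)
  have k5 := key B (by rw [hreal _ hB]; linarith)
  have k6 : ‖(σ * μ₀ * v ^ 2 - σ * μ₀ * w ^ 2 : ℂ)‖ ≤ L * |v - w| := by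
    have h1 : (σ * μ₀ * v ^ 2 - σ * μ₀ * w ^ 2 : ℂ) =
        ((σ * μ₀ * (v + w) : ℝ) : ℂ) * v - ((σ * μ₀ * (v + w) : ℝ) : ℂ) * w := by
      push_cast; ring
    rw [h1]
    refine key _ ?_
    rw [Complex.norm_real, Real.norm_eq_abs, abs_mul, abs_of_pos hσμ]
    have h2 : |v + w| ≤ 2 * b := (abs_add_le _ _).trans (by linarith)
    have h3 : σ * μ₀ * |v + w| ≤ σ * μ₀ * (2 * b) := by gcongr
    linarith
  push_cast at k3 k4
  rw [one_mul, one_mul] at k2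
  fin_cases i <;> fin_cases j <;> simp [coeffMatrix] <;> first
    | exact h0
    | exact k1
    | exact k2
    | exact k4
    | exact k6
    | (rw [neg_add_eq_sub, norm_sub_rev]; first | exact k3 | exact k5)

/-- For large `r` conjugators exist on the half-line `[0, ∞)`, uniformly on compact sets of
frequencies, and their values at `0` tend to the identity. The sign `s` allows for the reflection of
the half-line `(-∞, 0]`. -/
theorem eventually_exists_isConjugator {μ₀ σ B : ℝ} (hμ₀ : 0 < μ₀) (hσ : 0 < σ) (hB : 0 ≤ B)
    {s : ℂ} (hs : ‖s‖ = 1) {u : ℝ → ℝ} (hu : Continuous u) {uinf C θ : ℝ} (hC : 0 < C)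
    (hθ : 0 < θ) (hdec : ∀ x, 0 ≤ x → |u x - uinf| ≤ C * Real.exp (-θ * x)) {K : Set ℂ}
    (hK : IsCompact K) {δ : ℝ} (hδ : 0 < δ) :
    ∀ᶠ r : ℝ in atTop, ∀ z ∈ K, ∃ P, IsConjugator (fun x => s • coeffMatrix μ₀ σ B (u (r * x)) z)
      (s • coeffMatrix μ₀ σ B uinf z) (Ici 0) P ∧ ‖P 0 - 1‖ < δ := by
  obtain ⟨M, hM⟩ : ∃ M, ∀ z ∈ K, ‖s • coeffMatrix μ₀ σ B uinf z‖ ≤ M := by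
    have h1 : Continuous fun z : ℂ => ‖s • coeffMatrix μ₀ σ B uinf z‖ :=
      (((continuous_coeffMatrix μ₀ σ B).comp (Continuous.prodMk_right uinf)).const_smul s).norm
    obtain ⟨M, hM⟩ := hK.bddAbove_image h1.continuousOn
    exact ⟨M, fun z hz => hM ⟨z, hz, rfl⟩⟩
  obtain ⟨Z, hZ⟩ : ∃ Z, ∀ z ∈ K, ‖z‖ ≤ Z := hK.isBounded.exists_norm_le
  set b := |uinf| + C
  set L := Z + 1 + σ * B + σ * μ₀ + B + σ * μ₀ * (2 * b)
  set c := 4 * (L * C)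
  have hlim : Tendsto (fun r : ℝ => θ * r - 2 * M) atTop atTop :=
    tendsto_atTop_add_const_right _ _ (tendsto_id.const_mul_atTop hθ)
  filter_upwards [eventually_gt_atTop 0, hlim.eventually_gt_atTop (2 * M),
    hlim.eventually_ge_atTop (4 * c), hlim.eventually_gt_atTop (2 * c / δ),
    hlim.eventually_gt_atTop 0] with r hr h1 h2 h3 h4 z hz
  have hZ0 : 0 ≤ Z := (norm_nonneg z).trans (hZ z hz)
  have hL : 0 ≤ L := by positivity
  have hc : 0 ≤ c := by positivity
  have hcont : Continuous fun x : ℝ => s • coeffMatrix μ₀ σ B (u (r * x)) z :=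
    ((continuous_coeffMatrix μ₀ σ B).comp
      ((hu.comp (continuous_const_mul r)).prodMk continuous_const)).const_smul s
  have hdec' : ∀ x, 0 ≤ x →
      ‖s • coeffMatrix μ₀ σ B (u (r * x)) z - s • coeffMatrix μ₀ σ B uinf z‖ ≤
        c * Real.exp (-(θ * r) * x) := fun x hx => by
    have hrx : 0 ≤ r * x := by positivity
    have h5 := hdec (r * x) hrx
    have h6 : C * Real.exp (-θ * (r * x)) ≤ C :=
      mul_le_of_le_one_right hC.le (Real.exp_le_one_iff.2 (by
        rw [neg_mul]; exact neg_nonpos.2 (by positivity)))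
    have h7 : |u (r * x)| ≤ b := by
      have := abs_add_le (u (r * x) - uinf) uinf
      rw [sub_add_cancel] at this
      simp only [b]
      linarith
    rw [← smul_sub, norm_smul, hs, one_mul]
    refine (norm_coeffMatrix_sub_le hμ₀ hσ hB h7 (by simp only [b]; linarith) (hZ z hz)).trans ?_
    rw [show -(θ * r) * x = -θ * (r * x) by ring]
    calc 4 * (L * |u (r * x) - uinf|) ≤ 4 * (L * (C * Real.exp (-θ * (r * x)))) := by gcongr
      _ = _ := by simp only [c]; ring
  obtain ⟨P, hP⟩ := exists_conjugator hcont (hM z hz) hc h1 h2 hdec'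
  refine ⟨P, ⟨fun x hx => (hP x hx).1, fun x hx => (hP x hx).2.1,
    2 * c / (θ * r - 2 * M), θ * r - 4 * M, by linarith, fun x hx i j => ?_⟩, ?_⟩
  · rw [abs_of_nonneg hx]
    exact (entry_norm_le (P x - 1) i j).trans (hP x hx).2.2
  · have h5 := (hP 0 le_rfl).2.2
    rw [mul_zero, Real.exp_zero, mul_one] at h5
    refine h5.trans_lt ?_
    rw [div_lt_iff₀ h4]
    rw [div_lt_iff₀ hδ] at h3
    linarith

/-- The reflection `x ↦ -x` exchanges the conjugators on the two half-lines. -/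
theorem IsConjugator.reflect {A : ℝ → Matrix (Fin 4) (Fin 4) ℂ} {Ainf : Matrix (Fin 4) (Fin 4) ℂ}
    {I J : Set ℝ} {P : ℝ → Matrix (Fin 4) (Fin 4) ℂ} (h : IsConjugator A Ainf I P)
    (hIJ : ∀ x ∈ J, -x ∈ I) :
    IsConjugator (fun x => -A (-x)) (-Ainf) J (fun x => P (-x)) where
  ode x hx := by
    refine ((h.ode (-x) (hIJ x hx)).scomp x (hasDerivAt_neg x).hasDerivWithinAt hIJ).congr_deriv ?_
    rw [neg_one_smul]
    noncomm_ring
  isUnit x hx := h.isUnit _ (hIJ x hx)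
  decay := by
    obtain ⟨C, θ, hθ, hd⟩ := h.decay
    exact ⟨C, θ, hθ, fun x hx i j => by simpa using hd (-x) (hIJ x hx) i j⟩

/-- The bivector of a Kato basis is a least bivector at every point of the domain, also at `z = 0`,
where it is obtained as a limit. -/
theorem IsKatoBasis.isLeastBivector {X Y : Matrix (Fin 4) (Fin 4) ℂ}
    (hyp : ∀ z ∈ puncturedHalfPlane, ∀ κ ∈ spectrum ℂ (X + z • Y), κ.re ≠ 0) {Λ : Set ℂ}
    (hΛ : puncturedHalfPlane ⊆ Λ) (hΛ' : ∀ z ∈ Λ, 0 ≤ z.re) {R : ℂ → Matrix (Fin 4) (Fin 2) ℂ}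
    (hR : IsKatoBasis (fun z => stableProj (X + z • Y)) Λ R) {z : ℂ} (hz : z ∈ Λ) :
    IsLeastBivector (X + z • Y) (bivector (R z)) := by
  have hgen : ∀ z ∈ puncturedHalfPlane, IsLeastBivector (X + z • Y) (bivector (R z)) :=
    fun z hz => by
      obtain ⟨h1, h2⟩ := hR.basis_stableSubspace hyp hΛ hz
      exact isLeastBivector_of_basis (hyp z hz) h1 h2
  by_cases h0 : z = 0
  · subst h0
    have hmem : ∀ n : ℕ, (1 / ((n : ℂ) + 1)) ∈ puncturedHalfPlane := fun n => by
      have h1 : (1 / ((n : ℂ) + 1)) = ((1 / ((n : ℝ) + 1) : ℝ) : ℂ) := by push_cast; rfl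
      refine ⟨?_, ?_⟩
      · rw [h1, Complex.ofReal_re]; positivity
      · rw [h1, Complex.ofReal_ne_zero]; positivity
    have hlim : Tendsto (fun n : ℕ => (1 / ((n : ℂ) + 1))) atTop (𝓝 0) :=
      tendsto_one_div_add_atTop_nhds_zero_nat
    have hlim' : Tendsto (fun n : ℕ => (1 / ((n : ℂ) + 1))) atTop (𝓝[Λ] 0) :=
      tendsto_nhdsWithin_iff.2 ⟨hlim, Eventually.of_forall fun n => hΛ (hmem n)⟩
    have hA : Continuous fun z : ℂ => X + z • Y := by fun_prop
    have hb : Continuous bivector := by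
      unfold bivector
      exact (continuous_id.matrix_mul continuous_const).matrix_mul continuous_id.matrix_transpose
    refine IsLeastBivector.of_tendsto ((hA.tendsto 0).comp hlim)
      ((hb.tendsto _).comp ((hR.continuousOn 0 hz).tendsto.comp hlim'))
      (fun n => hgen _ (hmem n))
  · exact hgen z ⟨hΛ' z hz, h0⟩

theorem Continuous.detCols {T : Type*} [TopologicalSpace T] {X Y : T → Matrix (Fin 4) (Fin 2) ℂ}
    (hX : Continuous X) (hY : Continuous Y) : Continuous fun t => detCols (X t) (Y t) := by
  unfold _root_.detCols
  refine Continuous.matrix_det (continuous_matrix fun i j => ?_)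
  fin_cases j
  exacts [hX.matrix_elem i 0, hX.matrix_elem i 1, hY.matrix_elem i 0, hY.matrix_elem i 1]

/-- Uniformly on compact sets, the determinant changes little when the two bases are multiplied by
matrices close to the identity. -/
theorem exists_forall_dist_detCols_lt {Rp Rm : ℂ → Matrix (Fin 4) (Fin 2) ℂ} {K : Set ℂ}
    (hK : IsCompact K) (hp : ContinuousOn Rp K) (hm : ContinuousOn Rm K) {ε : ℝ} (hε : 0 < ε) :
    ∃ δ : ℝ, 0 < δ ∧ ∀ P Q : Matrix (Fin 4) (Fin 4) ℂ, (∀ i j, ‖(P - 1) i j‖ < δ) →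
      (∀ i j, ‖(Q - 1) i j‖ < δ) → ∀ z ∈ K,
        dist (detCols (Rp z) (Rm z)) (detCols (P * Rp z) (Q * Rm z)) < ε := by
  have hcont : ContinuousOn (Function.uncurry fun
      (p : Matrix (Fin 4) (Fin 4) ℂ × Matrix (Fin 4) (Fin 4) ℂ) (z : ℂ) =>
        detCols (p.1 * Rp z) (p.2 * Rm z)) (univ ×ˢ K) := by
    rw [continuousOn_iff_continuous_domRestrict] at hp hm ⊢
    let T := ((univ : Set (Matrix (Fin 4) (Fin 4) ℂ × Matrix (Fin 4) (Fin 4) ℂ)) ×ˢ K : Set _)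
    have hz : Continuous fun q : T => (⟨q.1.2, q.2.2⟩ : K) := by fun_prop
    have hp' : Continuous fun q : T => Rp q.1.2 := hp.comp hz
    have hm' : Continuous fun q : T => Rm q.1.2 := hm.comp hz
    have hP : Continuous fun q : T => q.1.1.1 := by fun_prop
    have hQ : Continuous fun q : T => q.1.1.2 := by fun_prop
    exact Continuous.detCols (hP.matrix_mul hp') (hQ.matrix_mul hm')
  obtain ⟨V, hV, hVK⟩ := hK.mem_uniformity_of_prod hcont (mem_univ (1, 1))
    (Metric.dist_mem_uniformity hε)
  rw [nhdsWithin_univ] at hV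
  obtain ⟨η, hη, hball⟩ := Metric.mem_nhds_iff.1 hV
  refine ⟨η / 8, by positivity, fun P Q hP hQ z hz => ?_⟩
  have hnorm : ∀ P : Matrix (Fin 4) (Fin 4) ℂ, (∀ i j, ‖(P - 1) i j‖ < η / 8) → dist P 1 < η :=
    fun P hP => by
      rw [dist_eq_norm]
      exact (norm_le_of_entries_le fun i j => (hP i j).le).trans_lt (by linarith)
  have hPQ : (P, Q) ∈ V := hball (by
    rw [Metric.mem_ball, Prod.dist_eq]
    exact max_lt (hnorm P hP) (hnorm Q hQ))
  have h := hVK (P, Q) hPQ z hz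
  rw [dist_comm]
  simpa using h

end Assembly

theorem mainTheorem11 (γ vp μ₀ σ B : ℝ) (hγ : 1 ≤ γ) (hvp : 0 < vp) (hvp1 : vp < 1)
    (hμ₀ : 0 < μ₀) (hσ : 0 < σ) (hB : 0 ≤ B)
    (vbar : ℝ → ℝ) (hvbar : IsShockProfile γ vp 1 vbar)
    (Rp Rm : ℂ → Matrix (Fin 4) (Fin 2) ℂ)
    (hRp : IsKatoBasis (fun z => stableProj (coeffMatrix μ₀ σ B vp z)) (evansDomain μ₀ B vp) Rp)
    (hRm : IsKatoBasis (fun z => unstableProj (coeffMatrix μ₀ σ B 1 z)) (evansDomain μ₀ B vp) Rm) :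
    (∀ z ∈ evansDomain μ₀ B vp, z ≠ 0 →
      (LinearIndependent ℂ (Rp z).col ∧
        Submodule.span ℂ (range (Rp z).col) = stableSubspace (coeffMatrix μ₀ σ B vp z)) ∧
      (LinearIndependent ℂ (Rm z).col ∧
        Submodule.span ℂ (range (Rm z).col) = unstableSubspace (coeffMatrix μ₀ σ B 1 z))) ∧
    ∀ K : Set ℂ, IsCompact K → K ⊆ evansDomain μ₀ B vp →
      (∀ᶠ r : ℝ in atTop, ∀ z ∈ K,
        ∃! d : ℂ, IsEvansValue μ₀ σ B vp Rp Rm (fun x => vbar (r * x)) z d) ∧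
      TendstoUniformlyOn
        (fun (r : ℝ) (z : ℂ) => reducedEvans μ₀ σ B vp Rp Rm (fun x => vbar (r * x)) z)
        (fun z => detCols (Rp z) (Rm z)) atTop K := by
  have hΛ : puncturedHalfPlane ⊆ evansDomain μ₀ B vp := fun z hz => ⟨hz.1, fun h => (hz.2 h).elim⟩
  have hΛ' : ∀ z ∈ evansDomain μ₀ B vp, 0 ≤ z.re := fun z hz => hz.1
  have hypp : ∀ z ∈ puncturedHalfPlane, ∀ κ ∈ spectrum ℂ
      (coeffMatrix μ₀ σ B vp 0 + z • coeffSlope vp), κ.re ≠ 0 := fun z hz κ hκ => by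
    rw [← coeffMatrix_eq] at hκ
    exact re_ne_zero_of_mem_spectrum_coeffMatrix hμ₀ hσ hvp hz hκ
  have hypm : ∀ z ∈ puncturedHalfPlane, ∀ κ ∈ spectrum ℂ
      (-coeffMatrix μ₀ σ B 1 0 + z • (-coeffSlope 1)), κ.re ≠ 0 := fun z hz κ hκ => by
    rw [← neg_coeffMatrix_eq, ← spectrum.neg_eq, Set.mem_neg] at hκ
    have := re_ne_zero_of_mem_spectrum_coeffMatrix hμ₀ hσ one_pos hz hκ
    simpa using this
  have hRp' : IsKatoBasis (fun z => stableProj (coeffMatrix μ₀ σ B vp 0 + z • coeffSlope vp))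
      (evansDomain μ₀ B vp) Rp := by simpa only [← coeffMatrix_eq] using hRp
  have hRm' : IsKatoBasis (fun z => stableProj (-coeffMatrix μ₀ σ B 1 0 + z • (-coeffSlope 1)))
      (evansDomain μ₀ B vp) Rm := by
    simpa only [← neg_coeffMatrix_eq, ← unstableProj_eq_stableProj_neg] using hRm
  refine ⟨fun z hz hz0 => ⟨?_, ?_⟩, fun K hK hKΛ => ?_⟩
  · have := hRp'.basis_stableSubspace hypp hΛ ⟨hz.1, hz0⟩
    rwa [← coeffMatrix_eq] at this
  · have := hRm'.basis_stableSubspace hypm hΛ ⟨hz.1, hz0⟩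
    rwa [← neg_coeffMatrix_eq, stableSubspace_neg] at this
  have hunique : ∀ (r : ℝ), ∀ z ∈ K, ∀ d d',
      IsEvansValue μ₀ σ B vp Rp Rm (fun x => vbar (r * x)) z d →
      IsEvansValue μ₀ σ B vp Rp Rm (fun x => vbar (r * x)) z d' → d = d' := by
    rintro r z hz d d' ⟨Pp, Pm, hPp, hPm, rfl⟩ ⟨Qp, Qm, hQp, hQm, rfl⟩
    have hcont : Continuous fun x => coeffMatrix μ₀ σ B (vbar (r * x)) z :=
      (continuous_coeffMatrix μ₀ σ B).comp
        ((hvbar.continuous.comp (continuous_const_mul r)).prodMk continuous_const)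
    have hp := hRp'.isLeastBivector hypp hΛ hΛ' (hKΛ hz)
    have hm := hRm'.isLeastBivector hypm hΛ hΛ' (hKΛ hz)
    rw [← coeffMatrix_eq] at hp
    rw [← neg_coeffMatrix_eq] at hm
    have hIJ : ∀ x ∈ Ici (0 : ℝ), -x ∈ Iic (0 : ℝ) := fun x hx => by
      simpa using hx
    have h1 := hPp.bivector_unique hcont hQp (bivector_transpose (Rp z)) hp
    have h2 := (hPm.reflect hIJ).bivector_unique (hcont.comp continuous_neg).neg (hQm.reflect hIJ)
      (bivector_transpose (Rm z)) hm
    rw [neg_zero] at h2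
    exact detCols_congr (by rw [bivector_mul, bivector_mul, h1])
      (by rw [bivector_mul, bivector_mul, h2])
  have hexists : ∀ δ : ℝ, 0 < δ → ∀ᶠ r : ℝ in atTop, ∀ z ∈ K,
      ∃ P Q : Matrix (Fin 4) (Fin 4) ℂ, (∀ i j, ‖(P - 1) i j‖ < δ) ∧ (∀ i j, ‖(Q - 1) i j‖ < δ) ∧
        IsEvansValue μ₀ σ B vp Rp Rm (fun x => vbar (r * x)) z
          (detCols (P * Rp z) (Q * Rm z)) := by
    intro δ hδ
    obtain ⟨C₁, θ₁, hC₁, hθ₁, hd₁⟩ := hvbar.exists_decay_atTop hγ hvp hvp1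
    obtain ⟨C₂, θ₂, hC₂, hθ₂, hd₂⟩ := hvbar.exists_decay_atBot hγ hvp hvp1
    filter_upwards [
      eventually_exists_isConjugator hμ₀ hσ hB (s := 1) norm_one hvbar.continuous hC₁ hθ₁ hd₁ hK hδ,
      eventually_exists_isConjugator hμ₀ hσ hB (s := -1) (by simp)
        (hvbar.continuous.comp continuous_neg) hC₂ hθ₂ hd₂ hK hδ] with r h1 h2 z hz
    obtain ⟨Pp, hPp, hPp0⟩ := h1 z hz
    obtain ⟨Pm, hPm, hPm0⟩ := h2 z hz
    have hPm' := hPm.reflect (J := Iic 0) fun x hx => by simpa using hx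
    simp only [one_smul] at hPp
    simp only [neg_one_smul, neg_neg, mul_neg, Function.comp_apply] at hPm'
    refine ⟨Pp 0, Pm 0, fun i j => (entry_norm_le _ i j).trans_lt hPp0,
      fun i j => (entry_norm_le _ i j).trans_lt hPm0, Pp, fun x => Pm (-x), hPp, hPm', ?_⟩
    simp only [neg_zero]
  have hspec : ∀ (r : ℝ), ∀ z ∈ K, ∀ d,
      IsEvansValue μ₀ σ B vp Rp Rm (fun x => vbar (r * x)) z d →
      reducedEvans μ₀ σ B vp Rp Rm (fun x => vbar (r * x)) z = d := fun r z hz d hd =>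
    hunique r z hz _ _ (Classical.epsilon_spec ⟨d, hd⟩) hd
  refine ⟨?_, ?_⟩
  · filter_upwards [hexists 1 one_pos] with r hr z hz
    obtain ⟨P, Q, -, -, hd⟩ := hr z hz
    exact ⟨_, hd, fun d' hd' => hunique r z hz _ _ hd' hd⟩
  · rw [Metric.tendstoUniformlyOn_iff]
    intro ε hε
    obtain ⟨δ, hδ, hclose⟩ := exists_forall_dist_detCols_lt hK (hRp.continuousOn.mono hKΛ)
      (hRm.continuousOn.mono hKΛ) hε
    filter_upwards [hexists δ hδ] with r hr z hz
    obtain ⟨P, Q, hP, hQ, hd⟩ := hr z hz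
    rw [hspec r z hz _ hd]
    exact hclose P Q hP hQ z hz
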